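/- Let $\mathbb F$ be a field of characteristic $0$. Let $\mathcal A$ be a Lie conformal algebra over $\mathbb F$ that is free as an $\mathbb F[\partial]$-module and contains a Virasoro element $L$, i.e. $[L_\lambda L]=(\partial+2\lambda)L$, $L_{(0)}:=[L_\lambda\,\cdot\,]|_{\lambda=0}=\partial$, and $L_{(1)}:=\frac{d}{d\lambda}[L_\lambda\,\cdot\,]|_{\lambda=0}$ is diagonalizable on $\mathcal A$. Let $M$ be an $\mathcal A$-module that is free as an $\mathbb F[\partial]$-module and conformal with respect to $L$, i.e. $(L_\lambda\,\cdot\,)|_{\lambda=0}=\partial^M$ and $\frac{d}{d\lambda}(L_\lambda\,\cdot\,)|_{\lambda=0}$ is diagonalizable on $M$. (Ranks may be infinite.) For $q\ge 0$ let $\widetilde C^q=\widetilde C^q(\mathcal A,M)$ be the space of $\mathbb F$-linear maps $f:\mathcal A^{\otimes q}\to M[\lambda_1,\dots,\lambda_q]$ that are conformally antilinear, $f_{\lambda_1,\dots,\lambda_q}(\dots,\partial a_i,\dots)=-\lambda_i f_{\lambda_1,\dots,\lambda_q}(\dots,a_i,\dots)$, and skew-symmetric under simultaneous permutations of the $a_i$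 and $\lambda_i$, with the differential $$(\mathbf d f)_{\lambda_1,\dots,\lambda_{q+1}}(a_1,\dots,a_{q+1})=\sum_{k}(-1)^{k+1}a_{k\,\lambda_k}f_{\dots,\hat\lambda_k,\dots}(\dots,\hat a_k,\dots)+\sum_{k<l}(-1)^{k+l}f_{\lambda_k+\lambda_l,\dots,\hat\lambda_k,\dots,\hat\lambda_l,\dots}([a_{k\,\lambda_k}a_l],\dots,\hat a_k,\dots,\hat a_l,\dots)$$ and $(\partial f)_{\lambda_1,\dots,\lambda_q}(a_1,\dots,a_q)=(\partial^M+\lambda_1+\dots+\lambda_q)f_{\lambda_1,\dots,\lambda_q}(a_1,\dots,a_q)$. Let $\widetilde{\mathrm H}^q(\mathcal A,M)$ be the (basic) cohomology of $(\widetilde C^\bullet,\mathbf d)$ and $\mathrm H^q(\mathcal A,M)$ the (reduced) cohomology of the quotient complex $C^\bullet=\widetilde C^\bullet/\partial\widetilde C^\bullet$. Define $\tau:\widetilde C^{q+1}\to\widetilde C^{q}$ by $$(\tau f)_{\lambda_1,\dots,\lambda_q}(a_1,\dots,a_q)=(-1)^{q}\tfrac{d}{d\lambda}f_{\lambda_1,\dots,\lambda_q,\lambda}(a_1,\dots,a_q,L)\big|_{\lambda=0}.$$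 Then for every $q\ge1$, $$\dim \mathrm H^q(\mathcal A,M)=\dim\widetilde{\mathrm H}^q(\mathcal A,M)+\dim\widetilde{\mathrm H}^{q+1}(\mathcal A,M)$$ (as cardinal numbers, if the dimensions are infinite). Moreover, if $(f_i)_{i\in I}$ are cocycles in $\widetilde C^q$ whose classes form a basis of $\widetilde{\mathrm H}^q(\mathcal A,M)$ and $(g_j)_{j\in J}$ are cocycles in $\widetilde C^{q+1}$ whose classes form a basis of $\widetilde{\mathrm H}^{q+1}(\mathcal A,M)$, then the images in $C^q$ of the $f_i$ and of the $\tau(\partial g_j)$ are cocycles, and their classes, indexed by the disjoint union $I\sqcup J$, form a basis of $\mathrm H^q(\mathcal A,M)$. -/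

import Mathlib

open scoped TensorProduct Polynomial

noncomputable section

namespace LieConformal

universe u v w

/-! The base field is `F`, an `F[∂]`-module is a module over Mathlib's `F[X]`, with `∂` the action
of `X`. The space `V[λ] = F[λ] ⊗ V` is `F[X] ⊗[F] V`, and `V[λ₁, …, λ_q]` is
`MvPolynomial (Fin q) F ⊗[F] V`. -/

/-- The operator `∂` on an `F[∂]`-module, as an `F`-linear map. -/
def del (F : Type u) (V : Type v) [Field F] [AddCommGroup V] [Module F V] [Module F[X] V]
    [IsScalarTower F F[X] V] : V →ₗ[F] V :=
  Algebra.lsmul F F V (Polynomial.X : F[X])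

section LambdaMaps

variable {F : Type u} [Field F]
variable {U : Type*} [AddCommGroup U] [Module F U]
variable {V : Type*} [AddCommGroup V] [Module F V]
variable {W : Type*} [AddCommGroup W] [Module F W]
variable {P : Type*} [CommRing P] [Algebra F P]

/-- Evaluate an element of `W[λ]` at `λ = p`, where `p` lies in a commutative `F`-algebra `P`. -/
def substLam (W : Type*) [AddCommGroup W] [Module F W] (p : P) : F[X] ⊗[F] W →ₗ[F] P ⊗[F] W :=
  LinearMap.rTensor W (Polynomial.aeval p : F[X] →ₐ[F] P).toLinearMap

/-- Evaluate an element of `W[λ₁, …, λ_q]` at `λ_i = p i`, where the `p i` lie in a commutative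
`F`-algebra `P`. -/
def substVars (W : Type*) [AddCommGroup W] [Module F W] {q : ℕ} (p : Fin q → P) :
    MvPolynomial (Fin q) F ⊗[F] W →ₗ[F] P ⊗[F] W :=
  LinearMap.rTensor W (MvPolynomial.aeval p : MvPolynomial (Fin q) F →ₐ[F] P).toLinearMap

/-- For a `λ`-product `B : u ⊗ v ↦ u_λ v ∈ W[λ]` and `p` in a commutative `F`-algebra `P`, the
product `u_p v ∈ P ⊗ W` with the parameter `λ` set to `p`, extended `P`-bilinearly to
`u ∈ P ⊗ U` and `v ∈ P ⊗ V`. -/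
def lamProd (B : U →ₗ[F] V →ₗ[F] F[X] ⊗[F] W) (p : P) :
    P ⊗[F] U →ₗ[P] P ⊗[F] V →ₗ[P] P ⊗[F] W :=
  LinearMap.liftBaseChange P
    ((LinearMap.liftBaseChangeEquiv (R := F) (M := V) (N := P ⊗[F] W) P).toLinearMap.restrictScalars F
      ∘ₗ B.compr₂ (substLam W p))

theorem lamProd_tmul (B : U →ₗ[F] V →ₗ[F] F[X] ⊗[F] W) (p s t : P) (x : U) (y : V) :
    lamProd B p (s ⊗ₜ x) (t ⊗ₜ y) = (s * t) • substLam W p (B x y) := by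
  simp [lamProd, mul_smul]

/-- The `j`-product `u_(j) v`, determined by `u_λ v = ∑ j, (λ ^ j / j!) (u_(j) v)`: it is `j!` times
the coefficient of `λ ^ j`. -/
def jProd (B : U →ₗ[F] V →ₗ[F] F[X] ⊗[F] W) (j : ℕ) : U →ₗ[F] V →ₗ[F] W :=
  (j.factorial : F) •
    B.compr₂ ((TensorProduct.lid F W).toLinearMap ∘ₗ LinearMap.rTensor W (Polynomial.lcoeff F j))

/-- The substitution `λ ↦ -λ - ∂` on `V[λ]`: it sends `∑ λ ^ j v_j` to `∑ (-λ - ∂) ^ j v_j`, where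
`∂` acts on `V`. -/
def substNegLamDel (F : Type u) (V : Type v) [Field F] [AddCommGroup V] [Module F V]
    [Module F[X] V] [IsScalarTower F F[X] V] : F[X] ⊗[F] V →ₗ[F] F[X] ⊗[F] V :=
  TensorProduct.lift
    ((LinearMap.lcomp F (F[X] ⊗[F] V) (TensorProduct.mk F F[X] V 1)) ∘ₗ
      (Polynomial.aeval
        (-(Algebra.lsmul F F (F[X] ⊗[F] V) (Polynomial.X : F[X])) -
          LinearMap.lTensor F[X] (del F V) : Module.End F (F[X] ⊗[F] V))).toLinearMap)

end LambdaMaps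

/-- The variable `λ` of `F[λ, μ]`. -/
abbrev lam (F : Type u) [Field F] : MvPolynomial (Fin 2) F := MvPolynomial.X 0

/-- The variable `μ` of `F[λ, μ]`. -/
abbrev mu (F : Type u) [Field F] : MvPolynomial (Fin 2) F := MvPolynomial.X 1

/-- A Lie conformal algebra structure on an `F[∂]`-module `A`. -/
class LieConformalAlgebra (F : Type u) (A : Type v) [Field F] [AddCommGroup A] [Module F A]
    [Module F[X] A] [IsScalarTower F F[X] A] where
  /-- The `λ`-bracket `a ⊗ b ↦ [a_λ b]`. -/
  bracket : A →ₗ[F] A →ₗ[F] F[X] ⊗[F] A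
  /-- `[∂a_λ b] = -λ [a_λ b]` -/
  bracket_del_left : ∀ a b : A, bracket (del F A a) b = -((Polynomial.X : F[X]) • bracket a b)
  /-- `[a_λ ∂b] = (∂ + λ) [a_λ b]` -/
  bracket_del_right : ∀ a b : A, bracket a (del F A b) =
    LinearMap.lTensor F[X] (del F A) (bracket a b) + (Polynomial.X : F[X]) • bracket a b
  /-- `[a_λ b] = -[b_{-λ-∂} a]` -/
  skew : ∀ a b : A, bracket a b = -(substNegLamDel F A (bracket b a))
  /-- `[a_λ [b_μ c]] = [[a_λ b]_{λ+μ} c] + [b_μ [a_λ c]]` in `A[λ, μ]`. -/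
  jacobi : ∀ a b c : A,
    lamProd bracket (lam F) (1 ⊗ₜ a) (lamProd bracket (mu F) (1 ⊗ₜ b) (1 ⊗ₜ c)) =
      lamProd bracket (lam F + mu F) (lamProd bracket (lam F) (1 ⊗ₜ a) (1 ⊗ₜ b)) (1 ⊗ₜ c) +
      lamProd bracket (mu F) (1 ⊗ₜ b) (lamProd bracket (lam F) (1 ⊗ₜ a) (1 ⊗ₜ c))

/-- A module structure over the Lie conformal algebra `A` on an `F[∂]`-module `M`. -/
class LCModule (F : Type u) (A : Type v) (M : Type w) [Field F]
    [AddCommGroup A] [Module F A] [Module F[X] A] [IsScalarTower F F[X] A]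
    [LieConformalAlgebra F A]
    [AddCommGroup M] [Module F M] [Module F[X] M] [IsScalarTower F F[X] M] where
  /-- The `λ`-action `a ⊗ m ↦ a_λ m`. -/
  act : A →ₗ[F] M →ₗ[F] F[X] ⊗[F] M
  /-- `(∂a)_λ m = -λ a_λ m` -/
  act_del_left : ∀ (a : A) (m : M), act (del F A a) m = -((Polynomial.X : F[X]) • act a m)
  /-- `a_λ (∂m) = (∂ + λ) a_λ m` -/
  act_del_right : ∀ (a : A) (m : M), act a (del F M m) =
    LinearMap.lTensor F[X] (del F M) (act a m) + (Polynomial.X : F[X]) • act a m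
  /-- `a_λ (b_μ m) - b_μ (a_λ m) = [a_λ b]_{λ+μ} m` in `M[λ, μ]`. -/
  jacobi : ∀ (a b : A) (m : M),
    lamProd act (lam F) (1 ⊗ₜ a) (lamProd act (mu F) (1 ⊗ₜ b) (1 ⊗ₜ m)) -
      lamProd act (mu F) (1 ⊗ₜ b) (lamProd act (lam F) (1 ⊗ₜ a) (1 ⊗ₜ m)) =
    lamProd act (lam F + mu F)
      (lamProd (LieConformalAlgebra.bracket (F := F) (A := A)) (lam F) (1 ⊗ₜ a) (1 ⊗ₜ b))
      (1 ⊗ₜ m)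

/-- An endomorphism is diagonalizable when the space is spanned by its eigenvectors. -/
def IsDiagonalizable {F : Type u} {V : Type v} [Field F] [AddCommGroup V] [Module F V]
    (T : Module.End F V) : Prop :=
  ⨆ μ : F, T.eigenspace μ = ⊤

section Virasoro

variable (F : Type u) {A : Type v} [Field F]
variable [AddCommGroup A] [Module F A] [Module F[X] A] [IsScalarTower F F[X] A]
variable [LieConformalAlgebra F A]

/-- `L` is a Virasoro element: `[L_λ L] = (∂ + 2λ) L`, `L_(0) = ∂`, and `L_(1)` is
diagonalizable. -/
structure IsVirasoroElement (L : A) : Prop where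
  bracket_self : LieConformalAlgebra.bracket (F := F) L L =
    (1 : F[X]) ⊗ₜ[F] del F A L + (2 * Polynomial.X : F[X]) ⊗ₜ[F] L
  zero_prod : jProd (LieConformalAlgebra.bracket (F := F) (A := A)) 0 L = del F A
  one_prod : IsDiagonalizable (jProd (LieConformalAlgebra.bracket (F := F) (A := A)) 1 L)

/-- The `A`-module `M` is conformal with respect to `L`: `L_(0)^M = ∂^M`, and `L_(1)^M` is
diagonalizable. -/
structure IsConformalModule (L : A) (M : Type w) [AddCommGroup M] [Module F M] [Module F[X] M]
    [IsScalarTower F F[X] M] [LCModule F A M] : Prop where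
  zero_prod : jProd (LCModule.act (F := F) (A := A) (M := M)) 0 L = del F M
  one_prod : IsDiagonalizable (jProd (LCModule.act (F := F) (A := A) (M := M)) 1 L)

end Virasoro

/-- `F`-linear maps `f : A^{⊗q} → M[λ₁, …, λ_q]`, written as multilinear maps in `q` arguments. For
`q = 0` this is the space `M`. -/
abbrev MultiMaps (F : Type u) (A : Type v) (M : Type w) [Field F] [AddCommGroup A] [Module F A]
    [AddCommGroup M] [Module F M] (q : ℕ) : Type (max u v w) :=
  MultilinearMap F (fun _ : Fin q => A) (MvPolynomial (Fin q) F ⊗[F] M)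

/-- The additive group structure on `MultiMaps`, declared again to help instance search. -/
instance multiMaps_addCommGroup (F : Type u) (A : Type v) (M : Type w) [Field F] [AddCommGroup A]
    [Module F A] [AddCommGroup M] [Module F M] (q : ℕ) : AddCommGroup (MultiMaps F A M q) :=
  inferInstance

section Complex

variable (F : Type u) (A : Type v) (M : Type w) [Field F]
variable [AddCommGroup A] [Module F A] [Module F[X] A] [IsScalarTower F F[X] A]
variable [AddCommGroup M] [Module F M] [Module F[X] M] [IsScalarTower F F[X] M]

/-- The space of `q`-cochains: the `f` that are
* conformally antilinear, `f_λ(a₁, …, ∂a_i, …, a_q) = -λ_i f_λ(a₁, …, a_q)`;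
* skew-symmetric, `f_{λ_σ(1), …, λ_σ(q)}(a_σ(1), …, a_σ(q)) = sign σ • f_λ(a₁, …, a_q)`. -/
def cochains (q : ℕ) : Submodule F (MultiMaps F A M q) where
  carrier := {f |
    (∀ (a : Fin q → A) (i : Fin q), f (Function.update a i (del F A (a i))) =
      -((MvPolynomial.X i : MvPolynomial (Fin q) F) • f a)) ∧
    (∀ (σ : Equiv.Perm (Fin q)) (a : Fin q → A),
      substVars M (fun i => (MvPolynomial.X (σ i) : MvPolynomial (Fin q) F)) (f (a ∘ σ)) =
        ((Equiv.Perm.sign σ : ℤˣ) : ℤ) • f a)}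
  add_mem' := by
    rintro f g ⟨hf, hf2⟩ ⟨hg, hg2⟩
    refine ⟨fun a i => ?_, fun σ a => ?_⟩
    · rw [add_apply, add_apply, hf, hg, smul_add, neg_add]
    · rw [add_apply, add_apply, map_add, hf2, hg2, smul_add]
  zero_mem' := by
    refine ⟨fun a i => ?_, fun σ a => ?_⟩ <;> simp
  smul_mem' := by
    rintro c f ⟨hf, hf2⟩
    refine ⟨fun a i => ?_, fun σ a => ?_⟩
    · rw [smul_apply, smul_apply, hf, smul_neg, smul_comm]
    · rw [smul_apply, smul_apply, map_smul, hf2, smul_comm]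

/-- The operator `∂` on cochains: `(∂f)_λ(a) = (∂^M + ∑ k, λ_k) f_λ(a)`. -/
def delCochain (q : ℕ) : MultiMaps F A M q →ₗ[F] MultiMaps F A M q :=
  LinearMap.compMultilinearMapₗ F
    (LinearMap.lTensor (MvPolynomial (Fin q) F) (del F M) +
      Algebra.lsmul F F (MvPolynomial (Fin q) F ⊗[F] M)
        (∑ k : Fin q, (MvPolynomial.X k : MvPolynomial (Fin q) F)))

variable {F A M}

/-- The part
`∑ k, (-1) ^ (k + 1) a_{k λ_k} f_{λ₁, …, λ̂_k, …, λ_{q+1}}(a₁, …, â_k, …, a_{q+1})`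
of the differential (the signs are those of the formula with indices starting at `1`). -/
def actionPart [LieConformalAlgebra F A] [LCModule F A M] {q : ℕ} (f : MultiMaps F A M q) :
    MultiMaps F A M (q + 1) :=
  ∑ k : Fin (q + 1), (-1 : ℤ) ^ (k : ℕ) •
    LinearMap.uncurryMid (M := fun _ : Fin (q + 1) => A) k
      { toFun := fun x =>
          (((lamProd (LCModule.act (F := F) (A := A) (M := M))
              (MvPolynomial.X k : MvPolynomial (Fin (q + 1)) F) (1 ⊗ₜ x)).restrictScalars F) ∘ₗ
            substVars M (fun j => (MvPolynomial.X (k.succAbove j) : MvPolynomial (Fin (q + 1)) F))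
          ).compMultilinearMap f
        map_add' := fun x y => by
          ext a
          simp [TensorProduct.tmul_add]
        map_smul' := fun c x => by
          ext a
          simp [TensorProduct.tmul_smul] }

instance multilinearMap_isScalarTower {P : Type*} [CommRing P] [Algebra F P] {q : ℕ} :
    IsScalarTower F P (MultilinearMap F (fun _ : Fin q => A) (P ⊗[F] M)) :=
  ⟨fun c p f => by
    ext a
    simp [smul_assoc]⟩

/-- `f_{p₁, …, p_{q+1}}(x, a₁, …, a_q)` for values `p i` in a commutative `F`-algebra `P`,
extended `P`-linearly to `x ∈ P ⊗ A`, as a multilinear map in `a₁, …, a_q`. -/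
def insertFirst {P : Type*} [CommRing P] [Algebra F P] {q : ℕ} (f : MultiMaps F A M (q + 1))
    (p : Fin (q + 1) → P) :
    P ⊗[F] A →ₗ[P] MultilinearMap F (fun _ : Fin q => A) (P ⊗[F] M) :=
  LinearMap.liftBaseChange P
    (LinearMap.compMultilinearMapₗ F (substVars M p) ∘ₗ
      MultilinearMap.curryLeft f)

theorem insertFirst_tmul {P : Type*} [CommRing P] [Algebra F P] {q : ℕ}
    (f : MultiMaps F A M (q + 1)) (p : Fin (q + 1) → P) (s : P) (x : A) (a : Fin q → A) :
    insertFirst f p (s ⊗ₜ x) a = s • substVars M p (f (Fin.cons x a)) := by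
  simp [insertFirst]

theorem insertFirst_add {P : Type*} [CommRing P] [Algebra F P] {q : ℕ}
    (f g : MultiMaps F A M (q + 1)) (p : Fin (q + 1) → P) (x : P ⊗[F] A) (a : Fin q → A) :
    insertFirst (f + g) p x a = insertFirst f p x a + insertFirst g p x a := by
  induction x with
  | zero => simp
  | tmul s y => simp [insertFirst_tmul]
  | add y z hy hz => simp only [map_add, add_apply, hy, hz]; abel

theorem insertFirst_smul {P : Type*} [CommRing P] [Algebra F P] {q : ℕ} (c : F)
    (f : MultiMaps F A M (q + 1)) (p : Fin (q + 1) → P) (x : P ⊗[F] A) (a : Fin q → A) :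
    insertFirst (c • f) p x a = c • insertFirst f p x a := by
  induction x with
  | zero => simp
  | tmul s y => rw [insertFirst_tmul, insertFirst_tmul, smul_apply, map_smul, smul_comm]
  | add y z hy hz => simp only [map_add, add_apply, hy, hz, smul_add]

/-- The part
`∑ k < l, (-1) ^ (k + l) f_{λ_k + λ_l, λ₁, …, λ̂_k, …, λ̂_l, …}([a_{k λ_k} a_l], a₁, …, â_k, …, â_l, …)`
of the differential of a `(q + 1)`-cochain. Here `l` runs over the `q + 2` arguments and `k` over the
`q + 1` arguments that remain when the `l`-th is deleted. -/
def bracketPart [LieConformalAlgebra F A] {q : ℕ} (f : MultiMaps F A M (q + 1)) :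
    MultiMaps F A M (q + 2) :=
  ∑ l : Fin (q + 2), ∑ k : Fin (q + 1), if k.castSucc < l then
    (-1 : ℤ) ^ ((k : ℕ) + (l : ℕ)) •
      LinearMap.uncurryMid (M := fun _ : Fin (q + 2) => A) l
        { toFun := fun y =>
            LinearMap.uncurryMid (M := fun _ : Fin (q + 1) => A) k
              ((insertFirst f (Fin.cons (MvPolynomial.X k.castSucc + MvPolynomial.X l)
                  (fun j => MvPolynomial.X (l.succAbove (k.succAbove j))) :
                  Fin (q + 1) → MvPolynomial (Fin (q + 2)) F)).restrictScalars F ∘ₗ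
                ((lamProd (LieConformalAlgebra.bracket (F := F) (A := A))
                  (MvPolynomial.X k.castSucc : MvPolynomial (Fin (q + 2)) F)).flip
                    (1 ⊗ₜ y)).restrictScalars F ∘ₗ
                TensorProduct.mk F (MvPolynomial (Fin (q + 2)) F) A 1)
          map_add' := fun x y => by
            ext a
            simp [TensorProduct.tmul_add]
          map_smul' := fun c x => by
            ext a
            simp [TensorProduct.tmul_smul] }
  else 0

theorem actionPart_apply [LieConformalAlgebra F A] [LCModule F A M] {q : ℕ}
    (f : MultiMaps F A M q) (a : Fin (q + 1) → A) :
    actionPart f a = ∑ k : Fin (q + 1), (-1 : ℤ) ^ (k : ℕ) •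
      lamProd (LCModule.act (F := F) (A := A) (M := M))
        (MvPolynomial.X k : MvPolynomial (Fin (q + 1)) F) (1 ⊗ₜ a k)
        (substVars M (fun j => (MvPolynomial.X (k.succAbove j) : MvPolynomial (Fin (q + 1)) F))
          (f (fun j => a (k.succAbove j)))) := by
  simp only [actionPart, sum_apply]
  rfl

theorem bracketPart_apply [LieConformalAlgebra F A] {q : ℕ} (f : MultiMaps F A M (q + 1))
    (a : Fin (q + 2) → A) :
    bracketPart f a = ∑ l : Fin (q + 2), ∑ k : Fin (q + 1), if k.castSucc < l then
      (-1 : ℤ) ^ ((k : ℕ) + (l : ℕ)) •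
        insertFirst f (Fin.cons (MvPolynomial.X k.castSucc + MvPolynomial.X l)
            (fun j => MvPolynomial.X (l.succAbove (k.succAbove j))) :
            Fin (q + 1) → MvPolynomial (Fin (q + 2)) F)
          (lamProd (LieConformalAlgebra.bracket (F := F) (A := A))
            (MvPolynomial.X k.castSucc : MvPolynomial (Fin (q + 2)) F)
            (1 ⊗ₜ a k.castSucc) (1 ⊗ₜ a l))
          (fun j => a (l.succAbove (k.succAbove j)))
      else 0 := by
  simp only [bracketPart, sum_apply]
  refine Finset.sum_congr rfl fun l _ => Finset.sum_congr rfl fun k _ => ?_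
  split_ifs with h
  · rw [smul_apply]
    congr 1
    have e : l.succAbove k = k.castSucc := Fin.succAbove_of_castSucc_lt l k h
    simp [Fin.removeNth, e]
    rfl
  · rfl

variable (F A M)

/-- The differential `d` of the basic complex (defined on all multilinear maps). On `0`-cochains it is
`(dm)_λ(a) = a_λ m`, as the second sum is empty. -/
def differential [LieConformalAlgebra F A] [LCModule F A M] :
    (q : ℕ) → MultiMaps F A M q →ₗ[F] MultiMaps F A M (q + 1)
  | 0 =>
    { toFun := fun f => actionPart f
      map_add' := fun f g => by
        ext a
        simp [actionPart_apply, Finset.sum_add_distrib]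
      map_smul' := fun c f => by
        ext a
        simp [actionPart_apply, smul_comm] }
  | q + 1 =>
    { toFun := fun f => actionPart f + bracketPart f
      map_add' := fun f g => by
        ext a
        simp only [add_apply, actionPart_apply, bracketPart_apply, insertFirst_add, map_add,
          smul_add, Finset.sum_add_distrib, ← add_assoc, ite_add_zero]
        abel
      map_smul' := fun c f => by
        ext a
        simp only [add_apply, smul_apply, actionPart_apply, bracketPart_apply, insertFirst_smul,
          map_smul, RingHom.id_apply, smul_add, Finset.smul_sum, smul_ite, smul_zero,
          LinearMap.map_smul_of_tower, smul_comm c] }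

end Complex

section Preserve
variable {F : Type u} {A : Type v} {M : Type w} [Field F]
variable {U : Type*} [AddCommGroup U] [Module F U]
variable {V : Type*} [AddCommGroup V] [Module F V]
variable {W : Type*} [AddCommGroup W] [Module F W]
variable {P : Type*} [CommRing P] [Algebra F P] {Q : Type*} [CommRing Q] [Algebra F Q]

theorem rTensor_smul (φ : P →ₐ[F] Q) (s : P) (z : P ⊗[F] W) :
    LinearMap.rTensor W φ.toLinearMap (s • z) = φ s • LinearMap.rTensor W φ.toLinearMap z := by
  induction z with
  | zero => simp
  | tmul t y => simp [TensorProduct.smul_tmul']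
  | add y z hy hz => simp only [map_add, smul_add, hy, hz]

theorem rTensor_substLam (φ : P →ₐ[F] Q) (p : P) (z : F[X] ⊗[F] W) :
    LinearMap.rTensor W φ.toLinearMap (substLam W p z) = substLam W (φ p) z := by
  induction z with
  | zero => simp
  | tmul t y => simp [substLam, Polynomial.aeval_algHom_apply]
  | add y z hy hz => simp only [map_add, hy, hz]

theorem rTensor_substVars (φ : P →ₐ[F] Q) {q : ℕ} (p : Fin q → P)
    (z : MvPolynomial (Fin q) F ⊗[F] W) :
    LinearMap.rTensor W φ.toLinearMap (substVars W p z) = substVars W (fun i => φ (p i)) z := by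
  induction z with
  | zero => simp
  | tmul t y =>
    simp only [substVars, LinearMap.rTensor_tmul, AlgHom.toLinearMap_apply]
    rw [← MvPolynomial.comp_aeval_apply]
  | add y z hy hz => simp only [map_add, hy, hz]

theorem rTensor_lamProd (φ : P →ₐ[F] Q) (B : U →ₗ[F] V →ₗ[F] F[X] ⊗[F] W) (p : P)
    (x : P ⊗[F] U) (y : P ⊗[F] V) :
    LinearMap.rTensor W φ.toLinearMap (lamProd B p x y) =
      lamProd B (φ p) (LinearMap.rTensor U φ.toLinearMap x)
        (LinearMap.rTensor V φ.toLinearMap y) := by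
  induction x with
  | zero => simp
  | tmul s x =>
    induction y with
    | zero => simp
    | tmul t y => simp [lamProd_tmul, rTensor_smul, rTensor_substLam]
    | add y z hy hz => simp only [map_add, hy, hz]
  | add y z hy hz => simp only [map_add, hy, hz, LinearMap.add_apply]

theorem substLam_smul (p : P) (s : F[X]) (z : F[X] ⊗[F] W) :
    substLam W p (s • z) = Polynomial.aeval p s • substLam W p z :=
  rTensor_smul (Polynomial.aeval p) s z

theorem substVars_smul {q : ℕ} (p : Fin q → P) (s : MvPolynomial (Fin q) F)
    (z : MvPolynomial (Fin q) F ⊗[F] W) :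
    substVars W p (s • z) = MvPolynomial.aeval p s • substVars W p z :=
  rTensor_smul (MvPolynomial.aeval p) s z

theorem substLam_lTensor (p : P) (T : V →ₗ[F] W) (z : F[X] ⊗[F] V) :
    substLam W p (LinearMap.lTensor F[X] T z) = LinearMap.lTensor P T (substLam V p z) := by
  induction z with
  | zero => simp
  | tmul t y => simp [substLam]
  | add y z hy hz => simp only [map_add, hy, hz]

theorem substVars_lTensor {q : ℕ} (p : Fin q → P) (T : V →ₗ[F] W)
    (z : MvPolynomial (Fin q) F ⊗[F] V) :
    substVars W p (LinearMap.lTensor _ T z) = LinearMap.lTensor P T (substVars V p z) := by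
  induction z with
  | zero => simp
  | tmul t y => simp [substVars]
  | add y z hy hz => simp only [map_add, hy, hz]

theorem lTensor_smul' (T : V →ₗ[F] W) (s : P) (z : P ⊗[F] V) :
    LinearMap.lTensor P T (s • z) = s • LinearMap.lTensor P T z := by
  induction z with
  | zero => simp
  | tmul t y => simp [TensorProduct.smul_tmul']
  | add y z hy hz => simp only [map_add, smul_add, hy, hz]

theorem exists_perm_succAbove {n : ℕ} (σ : Equiv.Perm (Fin (n + 1))) (k : Fin (n + 1)) :
    ∃ ρ : Equiv.Perm (Fin n), (∀ j, σ (k.succAbove j) = (σ k).succAbove (ρ j)) ∧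
      ((Equiv.Perm.sign σ : ℤˣ) : ℤ) * (-1) ^ (k : ℕ) =
        (-1) ^ ((σ k : Fin (n + 1)) : ℕ) * ((Equiv.Perm.sign ρ : ℤˣ) : ℤ) := by
  let π : Equiv.Perm (Fin (n + 1)) := k.cycleRange.symm.trans (σ.trans (σ k).cycleRange)
  have h0 : π 0 = 0 := by simp [π]
  obtain ⟨⟨p, ρ⟩, hρ⟩ := Equiv.Perm.decomposeFin.symm.surjective π
  have hp : p = 0 := by
    have := congrArg (fun e => e 0) hρ
    simpa [h0] using this
  subst hp
  have hs : ∀ j, π (Fin.succ j) = (ρ j).succ := by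
    intro j
    rw [← hρ]; simp
  refine ⟨ρ, fun j => ?_, ?_⟩
  · have := hs j
    simp only [π, Equiv.trans_apply, Fin.cycleRange_symm_succ] at this
    rw [← Fin.cycleRange_symm_succ (σ k), ← this]; simp
  · have h1 : Equiv.Perm.sign π = Equiv.Perm.sign ρ := by
      rw [← hρ]; simp
    have h2 : Equiv.Perm.sign π = (-1) ^ (k : ℕ) * Equiv.Perm.sign σ * (-1) ^ ((σ k : Fin _) : ℕ) := by
      simp only [π, Equiv.Perm.sign_trans, Equiv.Perm.sign_symm, Fin.sign_cycleRange]
      ac_rfl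
    rw [← h1, h2]
    push_cast
    have : ((-1 : ℤ) ^ ((σ k : Fin _) : ℕ)) * (-1 : ℤ) ^ ((σ k : Fin _) : ℕ) = 1 := by
      rw [← mul_pow]; simp
    linear_combination (-((Equiv.Perm.sign σ : ℤˣ) : ℤ) * (-1) ^ (k : ℕ)) * this

variable [AddCommGroup A] [Module F A] [Module F[X] A] [IsScalarTower F F[X] A]
variable [AddCommGroup M] [Module F M] [Module F[X] M] [IsScalarTower F F[X] M]

theorem cochain_del {q : ℕ} {f : MultiMaps F A M q} (hf : f ∈ cochains F A M q)
    (p : Fin q → P) (a : Fin q → A) (i : Fin q) :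
    substVars M p (f (Function.update a i (del F A (a i)))) = -(p i • substVars M p (f a)) := by
  rw [hf.1, map_neg, substVars_smul, MvPolynomial.aeval_X]

theorem cochain_perm {q : ℕ} {f : MultiMaps F A M q} (hf : f ∈ cochains F A M q)
    (p : Fin q → P) (σ : Equiv.Perm (Fin q)) (a : Fin q → A) :
    substVars M (fun i => p (σ i)) (f (a ∘ σ)) =
      ((Equiv.Perm.sign σ : ℤˣ) : ℤ) • substVars M p (f a) := by
  have := congrArg (substVars M p) (hf.2 σ a)
  rw [map_zsmul] at this
  rw [← this]
  have := rTensor_substVars (MvPolynomial.aeval p : MvPolynomial (Fin q) F →ₐ[F] P)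
    (fun i => (MvPolynomial.X (σ i) : MvPolynomial (Fin q) F)) (f (a ∘ σ))
  simp only [MvPolynomial.aeval_X] at this
  exact this.symm

theorem delCochain_apply {q : ℕ} (f : MultiMaps F A M q) (a : Fin q → A) :
    delCochain F A M q f a = LinearMap.lTensor (MvPolynomial (Fin q) F) (del F M) (f a) +
      (∑ k : Fin q, (MvPolynomial.X k : MvPolynomial (Fin q) F)) • f a := rfl

theorem delCochain_mem {q : ℕ} {f : MultiMaps F A M q}
    (hf : f ∈ cochains F A M q) : delCochain F A M q f ∈ cochains F A M q := by
  refine ⟨fun a i => ?_, fun σ a => ?_⟩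
  · rw [delCochain_apply, delCochain_apply, hf.1, map_neg, lTensor_smul', smul_add, smul_neg,
      smul_comm (MvPolynomial.X i : MvPolynomial (Fin q) F) (∑ k : Fin q, _), neg_add]
  · rw [delCochain_apply, delCochain_apply, map_add, substVars_lTensor, substVars_smul, hf.2,
      map_zsmul, smul_add, map_sum]
    simp only [MvPolynomial.aeval_X]
    rw [Equiv.sum_comp σ (fun k => (MvPolynomial.X k : MvPolynomial (Fin q) F)), smul_comm]

variable [LieConformalAlgebra F A] [LCModule F A M]

theorem actionPart_perm {q : ℕ} {f : MultiMaps F A M q} (hf : f ∈ cochains F A M q)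
    (σ : Equiv.Perm (Fin (q + 1))) (a : Fin (q + 1) → A) :
    substVars M (fun i => (MvPolynomial.X (σ i) : MvPolynomial (Fin (q + 1)) F))
      (actionPart f (a ∘ σ)) = ((Equiv.Perm.sign σ : ℤˣ) : ℤ) • actionPart f a := by
  rw [actionPart_apply, actionPart_apply, map_sum, Finset.smul_sum]
  conv_rhs => rw [← Equiv.sum_comp σ]
  refine Finset.sum_congr rfl fun k _ => ?_
  obtain ⟨ρ, h1, h2⟩ := exists_perm_succAbove σ k
  rw [map_zsmul]
  conv_lhs => rw [substVars, rTensor_lamProd]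
  simp only [LinearMap.rTensor_tmul, AlgHom.toLinearMap_apply, map_one, MvPolynomial.aeval_X,
    rTensor_substVars, Function.comp_apply, h1]
  have := cochain_perm hf (fun j => (MvPolynomial.X ((σ k).succAbove j) :
    MvPolynomial (Fin (q + 1)) F)) ρ (fun j => a ((σ k).succAbove j))
  simp only [Function.comp_def] at this
  rw [this, map_zsmul, smul_smul, smul_smul]
  congr 1
  have e1 : ((Equiv.Perm.sign ρ : ℤˣ) : ℤ) * ((Equiv.Perm.sign ρ : ℤˣ) : ℤ) = 1 := by
    rw [← Units.val_mul, Int.units_mul_self]; rfl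
  have e2 : ((Equiv.Perm.sign σ : ℤˣ) : ℤ) * ((Equiv.Perm.sign σ : ℤˣ) : ℤ) = 1 := by
    rw [← Units.val_mul, Int.units_mul_self]; rfl
  linear_combination ((Equiv.Perm.sign ρ : ℤˣ) : ℤ) * ((Equiv.Perm.sign σ : ℤˣ) : ℤ) * h2 - (-1) ^ (k : ℕ) *
    ((Equiv.Perm.sign ρ : ℤˣ) : ℤ) * e2 + (-1) ^ ((σ k : Fin _) : ℕ) * ((Equiv.Perm.sign σ : ℤˣ) : ℤ) * e1


/-- The summand of the second sum of the differential for the arguments `x`, `y` and the remaining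
ones `r`. -/
def brTerm {q n : ℕ} (f : MultiMaps F A M (q + 1)) (x y : Fin n) (r : Fin q → Fin n)
    (a : Fin n → A) : MvPolynomial (Fin n) F ⊗[F] M :=
  insertFirst f (Fin.cons (MvPolynomial.X x + MvPolynomial.X y) (fun j => MvPolynomial.X (r j)) :
      Fin (q + 1) → MvPolynomial (Fin n) F)
    (lamProd (LieConformalAlgebra.bracket (F := F) (A := A))
      (MvPolynomial.X x : MvPolynomial (Fin n) F) (1 ⊗ₜ a x) (1 ⊗ₜ a y))
    (fun j => a (r j))

theorem rTensor_insertFirst {q : ℕ} (f : MultiMaps F A M (q + 1)) (φ : P →ₐ[F] Q)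
    (p : Fin (q + 1) → P) (x : P ⊗[F] A) (a : Fin q → A) :
    LinearMap.rTensor M φ.toLinearMap (insertFirst f p x a) =
      insertFirst f (fun i => φ (p i)) (LinearMap.rTensor A φ.toLinearMap x) a := by
  induction x with
  | zero => simp
  | tmul s y => simp [insertFirst_tmul, rTensor_smul, rTensor_substVars]
  | add y z hy hz => simp only [map_add, add_apply, hy, hz]

theorem brTerm_rename {q n : ℕ} (f : MultiMaps F A M (q + 1)) (x y : Fin n) (r : Fin q → Fin n)
    (a : Fin n → A) (σ : Equiv.Perm (Fin n)) :
    substVars M (fun i => (MvPolynomial.X (σ i) : MvPolynomial (Fin n) F))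
      (brTerm f x y r (a ∘ σ)) = brTerm f (σ x) (σ y) (fun j => σ (r j)) a := by
  rw [brTerm, substVars, rTensor_insertFirst, rTensor_lamProd, brTerm]
  simp only [LinearMap.rTensor_tmul, AlgHom.toLinearMap_apply, map_one, MvPolynomial.aeval_X,
    Function.comp_apply]
  congr 3
  ext i : 1
  refine Fin.cases ?_ (fun j => ?_) i <;> simp

theorem insertFirst_perm {q : ℕ} {f : MultiMaps F A M (q + 1)}
    (hf : f ∈ cochains F A M (q + 1)) (p0 : P) (p : Fin q → P) (ρ : Equiv.Perm (Fin q))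
    (x : P ⊗[F] A) (a : Fin q → A) :
    insertFirst f (Fin.cons p0 (fun j => p (ρ j)) : Fin (q + 1) → P) x (fun j => a (ρ j)) =
      ((Equiv.Perm.sign ρ : ℤˣ) : ℤ) • insertFirst f (Fin.cons p0 p : Fin (q + 1) → P) x a := by
  induction x with
  | zero => simp
  | tmul s y =>
    rw [insertFirst_tmul, insertFirst_tmul, smul_comm]
    congr 1
    have := cochain_perm hf (Fin.cons p0 p : Fin (q + 1) → P)
      (Equiv.Perm.decomposeFin.symm (0, ρ)) (Fin.cons y a)
    rw [Equiv.Perm.decomposeFin.symm_sign, if_pos rfl, one_mul] at this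
    rw [← this]
    congr 2
    · congr 1
      ext i : 1
      refine Fin.cases ?_ (fun j => ?_) i <;> simp
    · ext i : 1
      refine Fin.cases ?_ (fun j => ?_) i <;> simp
  | add y z hy hz => simp only [map_add, add_apply, hy, hz, smul_add]

theorem insertFirst_lTensor_del {q : ℕ} {f : MultiMaps F A M (q + 1)}
    (hf : f ∈ cochains F A M (q + 1)) (p : Fin (q + 1) → P) (x : P ⊗[F] A) (a : Fin q → A) :
    insertFirst f p (LinearMap.lTensor P (del F A) x) a = -(p 0 • insertFirst f p x a) := by
  induction x with
  | zero => simp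
  | tmul s y =>
    have := cochain_del hf p (Fin.cons y a) 0
    simp only [Fin.cons_zero, Fin.update_cons_zero] at this
    rw [LinearMap.lTensor_tmul, insertFirst_tmul, insertFirst_tmul, this, smul_neg, smul_comm]
  | add y z hy hz => simp only [map_add, add_apply, hy, hz, smul_add, neg_add]

theorem insertFirst_substNegLamDel {q : ℕ} {f : MultiMaps F A M (q + 1)}
    (hf : f ∈ cochains F A M (q + 1)) (s t : P) (p : Fin q → P) (z : F[X] ⊗[F] A)
    (a : Fin q → A) :
    insertFirst f (Fin.cons (s + t) p : Fin (q + 1) → P) (substLam A s (substNegLamDel F A z)) a =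
      insertFirst f (Fin.cons (s + t) p : Fin (q + 1) → P) (substLam A t z) a := by
  have key : ∀ w : F[X] ⊗[F] A,
      insertFirst f (Fin.cons (s + t) p : Fin (q + 1) → P) (substLam A s
        ((-(Algebra.lsmul F F (F[X] ⊗[F] A) (Polynomial.X : F[X])) -
          LinearMap.lTensor F[X] (del F A) : Module.End F (F[X] ⊗[F] A)) w)) a =
      t • insertFirst f (Fin.cons (s + t) p : Fin (q + 1) → P) (substLam A s w) a := by
    intro w
    simp only [LinearMap.sub_apply, LinearMap.neg_apply, Algebra.lsmul_coe, map_sub, map_neg,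
      substLam_smul, Polynomial.aeval_X, substLam_lTensor]
    rw [sub_apply, neg_apply, insertFirst_lTensor_del hf, map_smul, smul_apply]
    simp only [Fin.cons_zero, add_smul]
    abel
  induction z with
  | zero => simp
  | tmul r y =>
    simp only [substNegLamDel, TensorProduct.lift.tmul, LinearMap.comp_apply,
      LinearMap.lcomp_apply, AlgHom.toLinearMap_apply, TensorProduct.mk_apply]
    induction r using Polynomial.induction_on' with
    | add r r' h h' =>
      simp only [map_add, LinearMap.add_apply, add_apply, TensorProduct.add_tmul, h, h']
    | monomial n c =>
      induction n with
      | zero =>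
        simp [substLam, Algebra.algebraMap_eq_smul_one, insertFirst_tmul]
      | succ n ih =>
        have e : (Polynomial.monomial (n + 1) c : F[X]) = Polynomial.X * Polynomial.monomial n c := by
          rw [Polynomial.X_mul_monomial]
        rw [e, map_mul, Polynomial.aeval_X, Module.End.mul_apply, key, ih,
          ← smul_eq_mul, ← TensorProduct.smul_tmul', substLam_smul, Polynomial.aeval_X, map_smul,
          smul_apply]
  | add y z hy hz => simp only [map_add, add_apply, hy, hz]

theorem brTerm_swap {q n : ℕ} {f : MultiMaps F A M (q + 1)} (hf : f ∈ cochains F A M (q + 1))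
    (x y : Fin n) (r : Fin q → Fin n) (a : Fin n → A) :
    brTerm f y x r a = -brTerm f x y r a := by
  rw [brTerm, brTerm, lamProd_tmul, lamProd_tmul, LieConformalAlgebra.skew (a y) (a x), map_neg,
    one_mul, one_smul, one_smul, map_neg, neg_apply, insertFirst_substNegLamDel hf,
    add_comm (MvPolynomial.X y)]

theorem bracketPart_two {q : ℕ} {f : MultiMaps F A M (q + 1)} (hf : f ∈ cochains F A M (q + 1))
    (a : Fin (q + 2) → A) :
    (2 : ℤ) • bracketPart f a = ∑ l : Fin (q + 2), ∑ k : Fin (q + 1),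
      (-1 : ℤ) ^ ((k : ℕ) + (l : ℕ)) •
        brTerm f (l.succAbove k) l (fun j => l.succAbove (k.succAbove j)) a := by
  have hB : bracketPart f a = ∑ p : Fin (q + 2) × Fin (q + 1) with p.2.castSucc < p.1,
      (-1 : ℤ) ^ ((p.2 : ℕ) + (p.1 : ℕ)) •
        brTerm f (p.1.succAbove p.2) p.1 (fun j => p.1.succAbove (p.2.succAbove j)) a := by
    rw [bracketPart_apply, ← Finset.sum_product', Finset.univ_product_univ, Finset.sum_filter]
    refine Finset.sum_congr rfl fun p _ => ?_
    split_ifs with h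
    · rw [Fin.succAbove_of_castSucc_lt _ _ h]
      rfl
    · rfl
  rw [← Finset.sum_product', Finset.univ_product_univ,
    ← Finset.sum_filter_add_sum_filter_not Finset.univ
      (fun p : Fin (q + 2) × Fin (q + 1) => p.2.castSucc < p.1), ← hB, two_zsmul]
  congr 1
  rw [hB]
  symm
  refine Finset.sum_bij (fun p hp => (p.2.succ, ⟨(p.1 : ℕ), ?_⟩)) ?_ ?_ ?_ ?_
  · have := (Finset.mem_filter.1 hp).2
    have h2 := p.2.2
    simp only [Fin.lt_def, Fin.val_castSucc] at this
    omega
  · intro p hp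
    have := (Finset.mem_filter.1 hp).2
    simp only [Finset.mem_filter, Finset.mem_univ, true_and, Fin.lt_def, Fin.val_castSucc,
      Fin.val_succ] at this ⊢
    omega
  · intro p hp p' hp' h
    simp only [Prod.mk.injEq, Fin.mk.injEq, Fin.succ_inj] at h
    exact Prod.ext (Fin.ext h.2) h.1
  · intro p hp
    have := (Finset.mem_filter.1 hp).2
    have hne : p.1 ≠ 0 := Fin.ne_zero_of_lt this
    refine ⟨(p.2.castSucc, p.1.pred hne), ?_, ?_⟩
    · simp only [Finset.mem_filter, Finset.mem_univ, true_and, Fin.lt_def, Fin.val_castSucc,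
        Fin.val_pred] at this ⊢
      omega
    · simp
  · rintro ⟨l, k⟩ hp
    have h : ¬ k.castSucc < l := (Finset.mem_filter.1 hp).2
    have hl : (l : ℕ) < q + 1 := by
      have := k.2
      simp only [Fin.lt_def, Fin.val_castSucc] at h
      omega
    have h' : l ≤ k.castSucc := not_lt.1 h
    have e1 : l.succAbove k = k.succ := Fin.succAbove_of_le_castSucc _ _ h'
    have e2 : k.succ.succAbove ⟨(l : ℕ), hl⟩ = l := by
      rw [Fin.succAbove_of_castSucc_lt]
      · ext; rfl
      · simp only [Fin.lt_def, Fin.le_def, Fin.val_castSucc, Fin.val_succ] at h' ⊢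
        omega
    have e3 : (fun j => l.succAbove (k.succAbove j)) =
        fun j => k.succ.succAbove ((⟨(l : ℕ), hl⟩ : Fin (q + 1)).succAbove j) := by
      funext j
      ext
      simp only [Fin.le_def, Fin.val_castSucc] at h'
      simp only [Fin.succAbove, Fin.lt_def]
      split_ifs <;> simp_all <;> omega
    simp only
    rw [e1, e2, e3, brTerm_swap hf, smul_neg, ← neg_smul]
    congr 1
    simp only [Fin.val_succ]
    ring

theorem bracketPart_perm [CharZero F] {q : ℕ} {f : MultiMaps F A M (q + 1)}
    (hf : f ∈ cochains F A M (q + 1))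
    (σ : Equiv.Perm (Fin (q + 2))) (a : Fin (q + 2) → A) :
    substVars M (fun i => (MvPolynomial.X (σ i) : MvPolynomial (Fin (q + 2)) F))
      (bracketPart f (a ∘ σ)) = ((Equiv.Perm.sign σ : ℤˣ) : ℤ) • bracketPart f a := by
  have h2 : ((2 : ℤ) : F) ≠ 0 := by norm_num
  have inj : ∀ u v : MvPolynomial (Fin (q + 2)) F ⊗[F] M, (2 : ℤ) • u = (2 : ℤ) • v → u = v := by
    intro u v h
    rw [← Int.cast_smul_eq_zsmul F, ← Int.cast_smul_eq_zsmul F] at h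
    exact smul_right_injective _ h2 h
  apply inj
  rw [← map_zsmul, smul_comm, bracketPart_two hf, bracketPart_two hf, map_sum, Finset.smul_sum]
  conv_rhs => rw [← Equiv.sum_comp σ]
  refine Finset.sum_congr rfl fun l _ => ?_
  obtain ⟨ρ, h1, h2⟩ := exists_perm_succAbove σ l
  rw [map_sum, Finset.smul_sum]
  conv_rhs => rw [← Equiv.sum_comp ρ]
  refine Finset.sum_congr rfl fun k _ => ?_
  obtain ⟨τ, h3, h4⟩ := exists_perm_succAbove ρ k
  rw [map_zsmul, brTerm_rename]
  simp only [h1, h3]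
  have := insertFirst_perm hf (MvPolynomial.X ((σ l).succAbove (ρ k)) + MvPolynomial.X (σ l))
    (fun j => (MvPolynomial.X ((σ l).succAbove ((ρ k).succAbove j)) :
      MvPolynomial (Fin (q + 2)) F)) τ (lamProd (LieConformalAlgebra.bracket (F := F) (A := A))
      (MvPolynomial.X ((σ l).succAbove (ρ k)) : MvPolynomial (Fin (q + 2)) F)
      (1 ⊗ₜ a ((σ l).succAbove (ρ k))) (1 ⊗ₜ a (σ l)))
      (fun j => a ((σ l).succAbove ((ρ k).succAbove j)))
  rw [brTerm, brTerm, this, smul_smul, smul_smul]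
  congr 1
  have e1 : ((Equiv.Perm.sign ρ : ℤˣ) : ℤ) * ((Equiv.Perm.sign ρ : ℤˣ) : ℤ) = 1 := by
    rw [← Units.val_mul, Int.units_mul_self]; rfl
  have e2 : ((Equiv.Perm.sign σ : ℤˣ) : ℤ) * ((Equiv.Perm.sign σ : ℤˣ) : ℤ) = 1 := by
    rw [← Units.val_mul, Int.units_mul_self]; rfl
  have e3 : ((Equiv.Perm.sign τ : ℤˣ) : ℤ) * ((Equiv.Perm.sign τ : ℤˣ) : ℤ) = 1 := by
    rw [← Units.val_mul, Int.units_mul_self]; rfl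
  have m : ∀ n : ℕ, (-1 : ℤ) ^ n * (-1) ^ n = 1 := fun n => by rw [← mul_pow]; simp
  rw [pow_add, pow_add]
  rcases Int.units_eq_one_or (Equiv.Perm.sign ρ) with r1 | r1 <;>
  rcases Int.units_eq_one_or (Equiv.Perm.sign σ) with r2 | r2 <;>
  rcases Int.units_eq_one_or (Equiv.Perm.sign τ) with r3 | r3 <;>
  simp only [r1, r2, r3, Units.val_one, Units.val_neg] at h2 h4 ⊢ <;>
  linarith [congrArg₂ (· * ·) h2 h4]


theorem lamProd_act_del_left (p : P) (x : A) (z : P ⊗[F] M) :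
    lamProd (LCModule.act (F := F) (A := A) (M := M)) p (1 ⊗ₜ del F A x) z =
      -(p • lamProd (LCModule.act (F := F) (A := A) (M := M)) p (1 ⊗ₜ x) z) := by
  induction z with
  | zero => simp
  | tmul s y =>
    rw [lamProd_tmul, lamProd_tmul, LCModule.act_del_left, map_neg, substLam_smul,
      Polynomial.aeval_X, smul_neg, smul_comm]
  | add y z hy hz => simp only [map_add, hy, hz, smul_add, neg_add]

theorem lamProd_act_del_right (p : P) (x : A) (z : P ⊗[F] M) :
    lamProd (LCModule.act (F := F) (A := A) (M := M)) p (1 ⊗ₜ x)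
        (LinearMap.lTensor P (del F M) z) =
      LinearMap.lTensor P (del F M)
        (lamProd (LCModule.act (F := F) (A := A) (M := M)) p (1 ⊗ₜ x) z) +
      p • lamProd (LCModule.act (F := F) (A := A) (M := M)) p (1 ⊗ₜ x) z := by
  induction z with
  | zero => simp
  | tmul s y =>
    rw [LinearMap.lTensor_tmul, lamProd_tmul, lamProd_tmul, LCModule.act_del_right, map_add,
      substLam_smul, Polynomial.aeval_X, smul_add, substLam_lTensor, lTensor_smul', smul_comm p]
  | add y z hy hz => 
    simp only [map_add, hy, hz, smul_add]
    abel

theorem lamProd_bracket_del_left (p : P) (x y : A) :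
    lamProd (LieConformalAlgebra.bracket (F := F) (A := A)) p (1 ⊗ₜ del F A x) (1 ⊗ₜ y) =
      -(p • lamProd (LieConformalAlgebra.bracket (F := F) (A := A)) p (1 ⊗ₜ x) (1 ⊗ₜ y)) := by
  rw [lamProd_tmul, lamProd_tmul, LieConformalAlgebra.bracket_del_left, map_neg, substLam_smul,
    Polynomial.aeval_X, smul_neg, smul_comm]

theorem lamProd_bracket_del_right (p : P) (x y : A) :
    lamProd (LieConformalAlgebra.bracket (F := F) (A := A)) p (1 ⊗ₜ x) (1 ⊗ₜ del F A y) =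
      LinearMap.lTensor P (del F A)
        (lamProd (LieConformalAlgebra.bracket (F := F) (A := A)) p (1 ⊗ₜ x) (1 ⊗ₜ y)) +
      p • lamProd (LieConformalAlgebra.bracket (F := F) (A := A)) p (1 ⊗ₜ x) (1 ⊗ₜ y) := by
  rw [lamProd_tmul, lamProd_tmul, LieConformalAlgebra.bracket_del_right, map_add,
    substLam_smul, Polynomial.aeval_X, smul_add, substLam_lTensor, lTensor_smul', smul_comm p]

theorem update_succAbove {n : ℕ} (a : Fin (n + 1) → A) (l : Fin (n + 1)) (m : Fin n) (v : A) :
    (fun j => Function.update a (l.succAbove m) v (l.succAbove j)) =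
      Function.update (fun j => a (l.succAbove j)) m v := by
  funext j
  by_cases h : j = m
  · subst h; simp
  · rw [Function.update_of_ne h, Function.update_of_ne]
    exact fun e => h (Fin.succAbove_right_injective e)

theorem actionPart_update {q : ℕ} {f : MultiMaps F A M q} (hf : f ∈ cochains F A M q)
    (a : Fin (q + 1) → A) (i : Fin (q + 1)) :
    actionPart f (Function.update a i (del F A (a i))) =
      -((MvPolynomial.X i : MvPolynomial (Fin (q + 1)) F) • actionPart f a) := by
  rw [actionPart_apply, actionPart_apply, Finset.smul_sum, ← Finset.sum_neg_distrib]
  refine Finset.sum_congr rfl fun k _ => ?_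
  rw [smul_comm (MvPolynomial.X i : MvPolynomial (Fin (q + 1)) F), ← zsmul_neg]
  congr 1
  rcases Fin.eq_self_or_eq_succAbove k i with h | ⟨j, h⟩
  · subst h
    simp [lamProd_act_del_left]
  · subst h
    rw [update_succAbove, cochain_del hf _ (fun j => a (k.succAbove j)) j,
      Function.update_of_ne (Fin.succAbove_ne k j).symm, map_neg, map_smul]

theorem insertFirst_update {q : ℕ} {f : MultiMaps F A M (q + 1)}
    (hf : f ∈ cochains F A M (q + 1)) (p : Fin (q + 1) → P) (x : P ⊗[F] A) (a : Fin q → A)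
    (i : Fin q) :
    insertFirst f p x (Function.update a i (del F A (a i))) =
      -(p i.succ • insertFirst f p x a) := by
  induction x with
  | zero => simp
  | tmul s y =>
    have := cochain_del hf p (Fin.cons y a) i.succ
    simp only [Fin.cons_succ, ← Fin.cons_update] at this
    rw [insertFirst_tmul, insertFirst_tmul, this, smul_neg, smul_comm]
  | add y z hy hz => simp only [map_add, add_apply, hy, hz, smul_add, neg_add]

theorem brTerm_update {q : ℕ} {f : MultiMaps F A M (q + 1)}
    (hf : f ∈ cochains F A M (q + 1)) (l : Fin (q + 2)) (k : Fin (q + 1)) (a : Fin (q + 2) → A)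
    (i : Fin (q + 2)) :
    brTerm f (l.succAbove k) l (fun j => l.succAbove (k.succAbove j))
        (Function.update a i (del F A (a i))) =
      -((MvPolynomial.X i : MvPolynomial (Fin (q + 2)) F) •
        brTerm f (l.succAbove k) l (fun j => l.succAbove (k.succAbove j)) a) := by
  rcases Fin.eq_self_or_eq_succAbove l i with h | ⟨m, h⟩
  · subst h
    simp only [brTerm, Function.update_self, Function.update_of_ne (Fin.succAbove_ne i _)]
    rw [lamProd_bracket_del_right, map_add, add_apply, insertFirst_lTensor_del hf, map_smul,
      smul_apply, Fin.cons_zero, add_smul]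
    abel
  · rcases Fin.eq_self_or_eq_succAbove k m with h' | ⟨m', h'⟩
    · subst h' h
      have e : ∀ j, Function.update a (l.succAbove m) (del F A (a (l.succAbove m)))
          (l.succAbove (m.succAbove j)) = a (l.succAbove (m.succAbove j)) := fun j =>
        Function.update_of_ne (fun e => Fin.succAbove_ne m j (Fin.succAbove_right_injective e)) _ _
      simp only [brTerm, Function.update_self, Function.update_of_ne (Fin.succAbove_ne l _).symm, e]
      rw [lamProd_bracket_del_left, map_neg, map_smul, neg_apply, smul_apply]
    · subst h' h
      have e : (fun j => Function.update a (l.succAbove (k.succAbove m'))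
          (del F A (a (l.succAbove (k.succAbove m')))) (l.succAbove (k.succAbove j))) =
          Function.update (fun j => a (l.succAbove (k.succAbove j))) m'
            (del F A (a (l.succAbove (k.succAbove m')))) := by
        rw [← update_succAbove (fun j => a (l.succAbove j)), ← update_succAbove a]
      have e' : Function.update a (l.succAbove (k.succAbove m'))
          (del F A (a (l.succAbove (k.succAbove m')))) (l.succAbove k) = a (l.succAbove k) :=
        Function.update_of_ne (fun e => Fin.succAbove_ne k m' (Fin.succAbove_right_injective e).symm) _ _
      simp only [brTerm, Function.update_of_ne (Fin.succAbove_ne l _).symm, e, e']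
      rw [insertFirst_update hf _ _ (fun j => a (l.succAbove (k.succAbove j))) m', Fin.cons_succ]

theorem two_zsmul_injective [CharZero F] {u v : P ⊗[F] M} (h : (2 : ℤ) • u = (2 : ℤ) • v) :
    u = v := by
  have h2 : ((2 : ℤ) : F) ≠ 0 := by norm_num
  rw [← Int.cast_smul_eq_zsmul F, ← Int.cast_smul_eq_zsmul F] at h
  exact smul_right_injective _ h2 h

theorem bracketPart_update [CharZero F] {q : ℕ} {f : MultiMaps F A M (q + 1)}
    (hf : f ∈ cochains F A M (q + 1)) (a : Fin (q + 2) → A) (i : Fin (q + 2)) :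
    bracketPart f (Function.update a i (del F A (a i))) =
      -((MvPolynomial.X i : MvPolynomial (Fin (q + 2)) F) • bracketPart f a) := by
  apply two_zsmul_injective
  rw [smul_neg, smul_comm, bracketPart_two hf, bracketPart_two hf, Finset.smul_sum,
    ← Finset.sum_neg_distrib]
  refine Finset.sum_congr rfl fun l _ => ?_
  rw [Finset.smul_sum, ← Finset.sum_neg_distrib]
  refine Finset.sum_congr rfl fun k _ => ?_
  rw [brTerm_update hf, smul_neg, smul_comm]

theorem differential_mem [CharZero F] {q : ℕ} {f : MultiMaps F A M q}
    (hf : f ∈ cochains F A M q) : differential F A M q f ∈ cochains F A M (q + 1) := by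
  cases q with
  | zero => exact ⟨actionPart_update hf, actionPart_perm hf⟩
  | succ q =>
    refine ⟨fun a i => ?_, fun σ a => ?_⟩
    · change actionPart f _ + bracketPart f _ = -(_ • (actionPart f a + bracketPart f a))
      rw [actionPart_update hf, bracketPart_update hf, smul_add, neg_add]
    · change substVars M _ (actionPart f _ + bracketPart f _) =
        _ • (actionPart f a + bracketPart f a)
      rw [map_add, actionPart_perm hf, bracketPart_perm hf, smul_add]

theorem insertFirst_delCochain {q : ℕ} (f : MultiMaps F A M (q + 1)) (p : Fin (q + 1) → P)
    (x : P ⊗[F] A) (a : Fin q → A) :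
    insertFirst (delCochain F A M (q + 1) f) p x a =
      LinearMap.lTensor P (del F M) (insertFirst f p x a) + (∑ i, p i) • insertFirst f p x a := by
  induction x with
  | zero => simp
  | tmul s y =>
    rw [insertFirst_tmul, insertFirst_tmul, delCochain_apply, map_add, substVars_lTensor,
      substVars_smul, map_sum, smul_add, lTensor_smul', smul_comm s]
    simp only [MvPolynomial.aeval_X]
  | add y z hy hz =>
    simp only [map_add, add_apply, hy, hz, smul_add]
    abel

theorem actionPart_delCochain {q : ℕ} (f : MultiMaps F A M q) :
    actionPart (delCochain F A M q f) = delCochain F A M (q + 1) (actionPart f) := by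
  ext a
  rw [delCochain_apply, actionPart_apply, actionPart_apply, map_sum, Finset.smul_sum,
    ← Finset.sum_add_distrib]
  refine Finset.sum_congr rfl fun k _ => ?_
  rw [delCochain_apply, map_add, substVars_lTensor, substVars_smul, map_sum, map_add,
    lamProd_act_del_right, map_smul, Fin.sum_univ_succAbove _ k, map_zsmul, smul_comm (_ + _)]
  simp only [MvPolynomial.aeval_X]
  rw [← smul_add, add_smul, add_assoc]

theorem bracketPart_delCochain {q : ℕ} (f : MultiMaps F A M (q + 1)) :
    bracketPart (delCochain F A M (q + 1) f) = delCochain F A M (q + 2) (bracketPart f) := by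
  ext a
  rw [delCochain_apply, bracketPart_apply, bracketPart_apply, map_sum, Finset.smul_sum,
    ← Finset.sum_add_distrib]
  refine Finset.sum_congr rfl fun l _ => ?_
  rw [map_sum, Finset.smul_sum, ← Finset.sum_add_distrib]
  refine Finset.sum_congr rfl fun k _ => ?_
  split_ifs with h
  · rw [insertFirst_delCochain, map_zsmul, smul_comm (∑ k : Fin (q + 2), _), ← smul_add]
    congr 3
    rw [Fin.sum_univ_succ, Fin.sum_univ_succAbove _ l, Fin.sum_univ_succAbove _ k,
      Fin.succAbove_of_castSucc_lt _ _ h]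
    simp only [Fin.cons_zero, Fin.cons_succ]
    ring
  · simp

theorem differential_delCochain {q : ℕ} (f : MultiMaps F A M q) :
    differential F A M q (delCochain F A M q f) =
      delCochain F A M (q + 1) (differential F A M q f) := by
  cases q with
  | zero => exact actionPart_delCochain f
  | succ q =>
    change actionPart _ + bracketPart _ = delCochain F A M _ (actionPart f + bracketPart f)
    rw [actionPart_delCochain, bracketPart_delCochain, map_add]

end Preserve

section Cohomology

variable (F : Type u) (A : Type v) (M : Type w) [Field F] [CharZero F]
variable [AddCommGroup A] [Module F A] [Module F[X] A] [IsScalarTower F F[X] A]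
variable [AddCommGroup M] [Module F M] [Module F[X] M] [IsScalarTower F F[X] M]

/-- The additive group structure on `C̃^q(A, M)`, declared again to help instance search. -/
instance cochains_addCommGroup (q : ℕ) : AddCommGroup (cochains F A M q) :=
  inferInstance

/-- The operator `∂` on the space `C̃^q(A, M)` of `q`-cochains. -/
def delC (q : ℕ) : cochains F A M q →ₗ[F] cochains F A M q :=
  (delCochain F A M q).restrict fun _ hf => delCochain_mem hf

/-- The space `C^q(A, M) = C̃^q / ∂ C̃^q` of reduced `q`-cochains. -/
abbrev ReducedCochains (q : ℕ) : Type (max u v w) :=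
  cochains F A M q ⧸ LinearMap.range (delC F A M q)

variable [LieConformalAlgebra F A] [LCModule F A M]

/-- The differential `d : C̃^q → C̃^{q+1}` of the basic complex. -/
def dC (q : ℕ) : cochains F A M q →ₗ[F] cochains F A M (q + 1) :=
  (differential F A M q).restrict fun _ hf => differential_mem hf

theorem dC_delC (q : ℕ) (f : cochains F A M q) :
    dC F A M q (delC F A M q f) = delC F A M (q + 1) (dC F A M q f) :=
  Subtype.ext (differential_delCochain (f : MultiMaps F A M q))

/-- The differential `C^q → C^{q+1}` of the reduced complex, induced by `d`. -/
def dRed (q : ℕ) : ReducedCochains F A M q →ₗ[F] ReducedCochains F A M (q + 1) :=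
  Submodule.mapQ _ _ (dC F A M q) (by
    rintro _ ⟨g, rfl⟩
    exact ⟨dC F A M q g, (dC_delC F A M q g).symm⟩)

/-- The space of `q`-cocycles of the basic complex. -/
def basicCocycles (q : ℕ) : Submodule F (cochains F A M q) :=
  LinearMap.ker (dC F A M q)

/-- The space of `q`-coboundaries of the basic complex, zero for `q = 0`. -/
def basicCoboundaries : (q : ℕ) → Submodule F (cochains F A M q)
  | 0 => ⊥
  | q + 1 => LinearMap.range (dC F A M q)

/-- The basic cohomology `H̃^q(A, M)`: cocycles modulo coboundaries. -/
abbrev BasicCohomology (q : ℕ) : Type (max u v w) :=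
  basicCocycles F A M q ⧸ (basicCoboundaries F A M q).submoduleOf (basicCocycles F A M q)

/-- The space of `q`-cocycles of the reduced complex. -/
def reducedCocycles (q : ℕ) : Submodule F (ReducedCochains F A M q) :=
  LinearMap.ker (dRed F A M q)

/-- The space of `q`-coboundaries of the reduced complex, zero for `q = 0`. -/
def reducedCoboundaries : (q : ℕ) → Submodule F (ReducedCochains F A M q)
  | 0 => ⊥
  | q + 1 => LinearMap.range (dRed F A M q)

/-- The (reduced) cohomology `H^q(A, M)`, the cohomology of the reduced complex. -/
abbrev ReducedCohomology (q : ℕ) : Type (max u v w) :=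
  reducedCocycles F A M q ⧸ (reducedCoboundaries F A M q).submoduleOf (reducedCocycles F A M q)

variable {F A M}

/-- The class `[f] ∈ H̃^q(A, M)` of a cocycle `f`. -/
def basicClass {q : ℕ} (f : basicCocycles F A M q) : BasicCohomology F A M q :=
  Submodule.Quotient.mk f

/-- The projection `f̄ ∈ C^q(A, M)` of a cochain `f ∈ C̃^q(A, M)`. -/
def proj {q : ℕ} (f : cochains F A M q) : ReducedCochains F A M q :=
  Submodule.Quotient.mk f

/-- `x ∈ H^q(A, M)` is the class `[f̄]` of the cochain `f`, that is, `f̄` is a cocycle of the reduced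
complex and `x` is its class. -/
def IsReducedClass {q : ℕ} (x : ReducedCohomology F A M q) (f : cochains F A M q) : Prop :=
  ∃ h : proj f ∈ reducedCocycles F A M q, x = Submodule.Quotient.mk ⟨proj f, h⟩

end Cohomology

section Tau

variable {F : Type u} {A : Type v} {M : Type w} [Field F]
variable [AddCommGroup A] [Module F A]
variable [AddCommGroup M] [Module F M]

/-- The map `M[λ₁, …, λ_q, λ] → M[λ₁, …, λ_q]`, `z ↦ (d/dλ) z |_{λ = 0}`. -/
def derivLast (F : Type u) (M : Type w) [Field F] [AddCommGroup M] [Module F M] (q : ℕ) :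
    MvPolynomial (Fin (q + 1)) F ⊗[F] M →ₗ[F] MvPolynomial (Fin q) F ⊗[F] M :=
  LinearMap.rTensor M
    ((MvPolynomial.aeval (Fin.snoc (fun i => MvPolynomial.X i) 0 :
        Fin (q + 1) → MvPolynomial (Fin q) F)).toLinearMap ∘ₗ
      (MvPolynomial.pderiv (R := F) (Fin.last q)).toLinearMap)

/-- `(τf)_{λ₁, …, λ_q}(a₁, …, a_q) = (-1)^q (d/dλ) f_{λ₁, …, λ_q, λ}(a₁, …, a_q, L) |_{λ = 0}` for a
`(q + 1)`-cochain `f`. -/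
def tauMulti (L : A) (q : ℕ) : MultiMaps F A M (q + 1) →ₗ[F] MultiMaps F A M q where
  toFun f := (-1 : ℤ) ^ q • (derivLast F M q ∘ₗ LinearMap.applyₗ L).compMultilinearMap f.curryRight
  map_add' f g := by
    ext a
    change (-1 : ℤ) ^ q • derivLast F M q (f (Fin.snoc a L) + g (Fin.snoc a L)) =
      (-1 : ℤ) ^ q • derivLast F M q (f (Fin.snoc a L)) +
        (-1 : ℤ) ^ q • derivLast F M q (g (Fin.snoc a L))
    rw [map_add, smul_add]
  map_smul' c f := by
    ext a
    change (-1 : ℤ) ^ q • derivLast F M q (c • f (Fin.snoc a L)) =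
      c • (-1 : ℤ) ^ q • derivLast F M q (f (Fin.snoc a L))
    rw [map_smul, smul_comm]

theorem tauMulti_apply (L : A) {q : ℕ} (f : MultiMaps F A M (q + 1)) (a : Fin q → A) :
    tauMulti L q f a = (-1 : ℤ) ^ q • derivLast F M q (f (Fin.snoc a L)) := rfl

theorem derivLast_smul {q : ℕ} (i : Fin q) (z : MvPolynomial (Fin (q + 1)) F ⊗[F] M) :
    derivLast F M q ((MvPolynomial.X i.castSucc : MvPolynomial (Fin (q + 1)) F) • z) =
      (MvPolynomial.X i : MvPolynomial (Fin q) F) • derivLast F M q z := by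
  induction z with
  | zero => simp
  | tmul s y =>
    simp [derivLast, TensorProduct.smul_tmul', Derivation.leibniz, MvPolynomial.pderiv_X]
  | add y z hy hz => simp only [map_add, smul_add, hy, hz]

theorem derivLast_rename {q : ℕ} (σ : Equiv.Perm (Fin q)) (σ' : Equiv.Perm (Fin (q + 1)))
    (h : ∀ i, σ' i.castSucc = (σ i).castSucc) (hl : σ' (Fin.last q) = Fin.last q)
    (z : MvPolynomial (Fin (q + 1)) F ⊗[F] M) :
    substVars M (fun i => (MvPolynomial.X (σ i) : MvPolynomial (Fin q) F)) (derivLast F M q z) =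
      derivLast F M q
        (substVars M (fun i => (MvPolynomial.X (σ' i) : MvPolynomial (Fin (q + 1)) F)) z) := by
  induction z with
  | zero => simp
  | tmul s y =>
    simp only [derivLast, substVars, LinearMap.rTensor_tmul, LinearMap.comp_apply,
      AlgHom.toLinearMap_apply, Derivation.coeFn_coe]
    congr 1
    have e : (MvPolynomial.aeval (fun i => (MvPolynomial.X (σ' i) :
        MvPolynomial (Fin (q + 1)) F)) s) = MvPolynomial.rename σ' s := by
      rw [MvPolynomial.rename_eq_aeval]; rfl
    rw [e]
    have e2 := MvPolynomial.pderiv_rename σ'.injective (Fin.last q) s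
    rw [hl] at e2
    rw [e2, MvPolynomial.aeval_rename]
    rw [MvPolynomial.comp_aeval_apply]
    congr 2
    ext i : 1
    refine Fin.lastCases ?_ (fun j => ?_) i <;> simp [h, hl]
  | add y z hy hz => simp only [map_add, hy, hz]

theorem exists_perm_castSucc {q : ℕ} (σ : Equiv.Perm (Fin q)) :
    ∃ σ' : Equiv.Perm (Fin (q + 1)), (∀ i, σ' i.castSucc = (σ i).castSucc) ∧
      σ' (Fin.last q) = Fin.last q ∧ Equiv.Perm.sign σ' = Equiv.Perm.sign σ := by
  refine ⟨finSuccEquivLast.symm.permCongr (Equiv.optionCongr σ), fun i => ?_, ?_, ?_⟩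
  · simp [Equiv.permCongr_apply]
  · simp [Equiv.permCongr_apply]
  · rw [Equiv.Perm.sign_permCongr, Equiv.optionCongr_sign]

variable [Module F[X] A] [IsScalarTower F F[X] A]

theorem tauMulti_mem (L : A) {q : ℕ} {f : MultiMaps F A M (q + 1)}
    (hf : f ∈ cochains F A M (q + 1)) : tauMulti L q f ∈ cochains F A M q := by
  refine ⟨fun a i => ?_, fun σ a => ?_⟩
  · have := hf.1 (Fin.snoc a L) i.castSucc
    rw [Fin.snoc_castSucc, ← Fin.snoc_update] at this
    rw [tauMulti_apply, tauMulti_apply, this, map_neg, derivLast_smul, smul_comm, smul_neg]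
  · obtain ⟨σ', h, hl, hs⟩ := exists_perm_castSucc σ
    have := hf.2 σ' (Fin.snoc a L)
    have e : (Fin.snoc a L : Fin (q + 1) → A) ∘ σ' = Fin.snoc (a ∘ σ) L := by
      funext i
      refine Fin.lastCases ?_ (fun j => ?_) i <;> simp [h, hl]
    rw [e, hs] at this
    rw [tauMulti_apply, tauMulti_apply, map_zsmul, derivLast_rename σ σ' h hl, this, map_zsmul,
      smul_comm]

/-- The operator `τ : C̃^{q+1} → C̃^q` attached to `L`. -/
def tau (M : Type w) [AddCommGroup M] [Module F M] (L : A) (q : ℕ) :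
    cochains F A M (q + 1) →ₗ[F] cochains F A M q :=
  (tauMulti L q).restrict fun _ hf => tauMulti_mem L hf

end Tau

end LieConformal

end

open LieConformal

/-!
Cartan's formula for the contraction `k` with `L` at `λ = 0` reads `L_{(0)} = d k + k d`, and
`L_{(0)}` acts on `C̃` as `∂`, because it is `∂` both on `A` and on `M`. So `∂` is null-homotopic in
positive degrees, where it is also injective, and the long exact cohomology sequence of
`0 → C̃ → C̃ → C → 0`, whose first map is `∂`, breaks up into short exact sequences. The contraction
`k` splits these: if `g` is a cocycle, then `d (k g) = ∂ g`, so that `k g` is a cocycle of `C` that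
the connecting map sends to `g`. Finally `τ (∂ g) = ∂ (τ g) + k g`.

To prove `d² = 0` and Cartan's formula, a cochain `f` is viewed as a function of `q` arguments
`(p, x) ∈ P × (P ⊗ A)`, with `P` a commutative algebra in which the `λᵢ` take their values. This
turns `d` into the Chevalley–Eilenberg differential of the bracket
`[(p, x), (r, y)] = (p + r, [x_p y])`. On skew-symmetric functions it coincides with the Leibniz
differential, for which both facts follow by induction on the degree from the commutation rules of
contractions and Lie derivatives.
-/

noncomputable section

namespace LieConformal

section NullHomotopy

variable {R : Type*} [Ring R] {C : ℕ → Type*} [∀ q, AddCommGroup (C q)] [∀ q, Module R (C q)]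
  {d : ∀ q, C q →ₗ[R] C (q + 1)} {T : ∀ q, C q →ₗ[R] C q} {k : ∀ q, C (q + 1) →ₗ[R] C q}

/-- The cohomology at `V` of the sequence `U → V → W`. -/
abbrev CohomologyAt {U V W : Type*} [AddCommGroup U] [AddCommGroup V] [AddCommGroup W]
    [Module R U] [Module R V] [Module R W] (f : U →ₗ[R] V) (g : V →ₗ[R] W) : Type _ :=
  LinearMap.ker g ⧸ (LinearMap.range f).submoduleOf (LinearMap.ker g)

variable (d T k) in
/-- `T` is an endomorphism of the cochain complex `(C, d)`, and in positive degrees it is injective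
and null-homotopic, with homotopy `k`. -/
structure IsInjectiveNullHomotopy : Prop where
  d_d (q : ℕ) (x : C q) : d (q + 1) (d q x) = 0
  d_comm (q : ℕ) (x : C q) : d q (T q x) = T (q + 1) (d q x)
  homotopy (q : ℕ) (x : C (q + 1)) : T (q + 1) x = d q (k q x) + k (q + 1) (d (q + 1) x)
  injective (q : ℕ) : Function.Injective (T (q + 1))

namespace IsInjectiveNullHomotopy

variable (h : IsInjectiveNullHomotopy d T k)

include h in
theorem range_le_comap (q : ℕ) :
    LinearMap.range (T q) ≤ (LinearMap.range (T (q + 1))).comap (d q) := by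
  rintro _ ⟨x, rfl⟩
  exact ⟨d q x, (h.d_comm q x).symm⟩

/-- The differential of the quotient complex `C ⧸ T C`. -/
def quotD (q : ℕ) : (C q ⧸ LinearMap.range (T q)) →ₗ[R] C (q + 1) ⧸ LinearMap.range (T (q + 1)) :=
  Submodule.mapQ _ _ (d q) (h.range_le_comap q)

theorem mkQ_mem_ker_quotD_iff {q : ℕ} {x : C q} :
    (LinearMap.range (T q)).mkQ x ∈ LinearMap.ker (h.quotD q) ↔ ∃ y, T (q + 1) y = d q x := by
  simp only [quotD, LinearMap.mem_ker, Submodule.mkQ_apply, Submodule.mapQ_apply,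
    Submodule.Quotient.mk_eq_zero, LinearMap.mem_range]

theorem mkQ_mem_range_quotD_iff {q : ℕ} {x : C (q + 1)} :
    (LinearMap.range (T (q + 1))).mkQ x ∈ LinearMap.range (h.quotD q) ↔
      ∃ y z, d q y + T (q + 1) z = x := by
  simp only [quotD, LinearMap.mem_range, (Submodule.mkQ_surjective _).exists, Submodule.mkQ_apply,
    Submodule.mapQ_apply, Submodule.Quotient.eq']
  exact exists_congr fun y => exists_congr fun z => by rw [eq_neg_add_iff_add_eq]

include h in
theorem d_k_of_mem_ker {q : ℕ} {x : C (q + 1)} (hx : x ∈ LinearMap.ker (d (q + 1))) :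
    d q (k q x) = T (q + 1) x := by
  rw [h.homotopy, LinearMap.mem_ker.1 hx, map_zero, add_zero]

/-- The map from the cocycles of `C` to those of `C ⧸ T C` induced by the projection. -/
def projCocycle (q : ℕ) : LinearMap.ker (d q) →ₗ[R] LinearMap.ker (h.quotD q) :=
  ((LinearMap.range (T q)).mkQ ∘ₗ Submodule.subtype _).codRestrict _ fun x =>
    h.mkQ_mem_ker_quotD_iff.2 ⟨0, (map_zero _).trans (LinearMap.mem_ker.1 x.2).symm⟩

/-- The map `k` from the cocycles of `C` to those of `C ⧸ T C`: it lands there because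
`d (k x) = T x` for a cocycle `x`. -/
def homotopyCocycle (q : ℕ) : LinearMap.ker (d (q + 1)) →ₗ[R] LinearMap.ker (h.quotD q) :=
  ((LinearMap.range (T q)).mkQ ∘ₗ k q ∘ₗ Submodule.subtype _).codRestrict _ fun x =>
    h.mkQ_mem_ker_quotD_iff.2 ⟨x, (h.d_k_of_mem_ker x.2).symm⟩

/-- The map induced by the projection `C → C ⧸ T C` in cohomology. -/
def projClass (q : ℕ) :
    CohomologyAt (d q) (d (q + 1)) →ₗ[R] CohomologyAt (h.quotD q) (h.quotD (q + 1)) :=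
  Submodule.mapQ _ _ (h.projCocycle (q + 1)) <| by
    rintro x ⟨y, hy⟩
    exact h.mkQ_mem_range_quotD_iff.2 ⟨y, 0, by rw [map_zero, add_zero]; exact hy⟩

/-- The map induced by the homotopy `k` in cohomology; it splits the connecting map of
`0 → C → C → C ⧸ T C → 0`. -/
def homotopyClass (q : ℕ) :
    CohomologyAt (d (q + 1)) (d (q + 2)) →ₗ[R] CohomologyAt (h.quotD q) (h.quotD (q + 1)) :=
  Submodule.mapQ _ _ (h.homotopyCocycle (q + 1)) <| by
    rintro x ⟨y, hy⟩
    refine h.mkQ_mem_range_quotD_iff.2 ⟨-k q y, y, ?_⟩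
    rw [map_neg, h.homotopy, neg_add_cancel_left]
    exact congrArg (k (q + 1)) hy

theorem coprod_injective (q : ℕ) :
    Function.Injective ((h.projClass q).coprod (h.homotopyClass q)) := by
  rw [injective_iff_map_eq_zero]
  rintro ⟨x, y⟩ hxy
  obtain ⟨⟨f, hf⟩, rfl⟩ := Submodule.mkQ_surjective _ x
  obtain ⟨⟨g, hg⟩, rfl⟩ := Submodule.mkQ_surjective _ y
  have sum_exact : h.projCocycle (q + 1) ⟨f, hf⟩ + h.homotopyCocycle (q + 1) ⟨g, hg⟩ ∈
      (LinearMap.range (h.quotD q)).submoduleOf _ := (Submodule.Quotient.mk_eq_zero _).1 hxy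
  obtain ⟨u, v, huv⟩ : ∃ u v, d q u + T (q + 1) v = f + k (q + 1) g :=
    h.mkQ_mem_range_quotD_iff.1 sum_exact
  have g_exact : d (q + 1) v = g := h.injective (q + 1) <| by
    rw [← h.d_k_of_mem_ker hg, ← h.d_comm, ← zero_add (d (q + 1) (k (q + 1) g)),
      ← LinearMap.mem_ker.1 hf, ← map_add, ← huv, map_add, h.d_d, zero_add]
  have f_exact : d q (u + k q v) = f := by
    rw [h.homotopy, g_exact, ← add_assoc] at huv
    rw [map_add, add_right_cancel huv]
  exact Prod.ext ((Submodule.Quotient.mk_eq_zero _).2 ⟨_, f_exact⟩)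
    ((Submodule.Quotient.mk_eq_zero _).2 ⟨_, g_exact⟩)

theorem coprod_surjective (q : ℕ) :
    Function.Surjective ((h.projClass q).coprod (h.homotopyClass q)) := by
  intro x
  obtain ⟨⟨y, hy⟩, rfl⟩ := Submodule.mkQ_surjective _ x
  obtain ⟨f, rfl⟩ := Submodule.mkQ_surjective _ y
  obtain ⟨g, hg⟩ := h.mkQ_mem_ker_quotD_iff.1 hy
  have g_closed : g ∈ LinearMap.ker (d (q + 2)) := h.injective (q + 2) <| by
    rw [← h.d_comm, hg, h.d_d, map_zero]
  have sub_closed : f - k (q + 1) g ∈ LinearMap.ker (d (q + 1)) := by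
    rw [LinearMap.mem_ker, map_sub, h.d_k_of_mem_ker g_closed, hg, sub_self]
  refine ⟨(Submodule.mkQ _ ⟨_, sub_closed⟩, Submodule.mkQ _ ⟨g, g_closed⟩), ?_⟩
  refine congrArg (Submodule.mkQ _) (Subtype.ext ?_ : h.projCocycle (q + 1) ⟨_, sub_closed⟩ +
    h.homotopyCocycle (q + 1) ⟨g, g_closed⟩ = ⟨_, hy⟩)
  exact congrArg (Submodule.mkQ _) (sub_add_cancel f (k (q + 1) g))

/-- The splitting of the long exact cohomology sequence of `0 → C → C → C ⧸ T C → 0`, whose first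
map is `T`. -/
def cohomologyEquiv (q : ℕ) :
    (CohomologyAt (d q) (d (q + 1)) × CohomologyAt (d (q + 1)) (d (q + 2))) ≃ₗ[R]
      CohomologyAt (h.quotD q) (h.quotD (q + 1)) :=
  LinearEquiv.ofBijective _ ⟨h.coprod_injective q, h.coprod_surjective q⟩

theorem cohomologyEquiv_inl (q : ℕ) (f : LinearMap.ker (d (q + 1))) :
    h.cohomologyEquiv q (Submodule.Quotient.mk f, 0) =
      Submodule.Quotient.mk (h.projCocycle (q + 1) f) := by
  simp [cohomologyEquiv, projClass]

theorem cohomologyEquiv_inr (q : ℕ) (g : LinearMap.ker (d (q + 2))) :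
    h.cohomologyEquiv q (0, Submodule.Quotient.mk g) =
      Submodule.Quotient.mk (h.homotopyCocycle (q + 1) g) := by
  simp [cohomologyEquiv, homotopyClass]

end IsInjectiveNullHomotopy

end NullHomotopy

section Leibniz

variable {R : Type*} [CommRing R] {G : Type*} {N : Type*} [AddCommGroup N] [Module R N]

/-- Contraction with `x`: the insertion of `x` as the first argument of a cochain. -/
def contract (R : Type*) [CommRing R] [Module R N] {q : ℕ} (x : G) :
    ((Fin (q + 1) → G) → N) →ₗ[R] ((Fin q → G) → N) :=
  LinearMap.funLeft R N fun y : Fin q → G => (Fin.cons x y : Fin (q + 1) → G)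

@[simp]
theorem contract_apply {q : ℕ} (x : G) (φ : (Fin (q + 1) → G) → N) (y : Fin q → G) :
    contract R x φ y = φ (Fin.cons x y) := rfl

theorem contract_ext {q : ℕ} {φ ψ : (Fin (q + 1) → G) → N}
    (h : ∀ x, contract R x φ = contract R x ψ) : φ = ψ := by
  funext y
  simpa only [contract_apply, Fin.cons_self_tail] using congrFun (h (y 0)) (Fin.tail y)

variable (br : G → G → G) (act : G → N →ₗ[R] N)

/-- The Lie derivative along `x` of a cochain on a set `G` with a binary bracket, with values in a
module on which the elements of `G` act. -/
def lieDer {q : ℕ} (x : G) : ((Fin q → G) → N) →ₗ[R] ((Fin q → G) → N) :=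
  LinearMap.pi fun y => act x ∘ₗ LinearMap.proj y -
    ∑ i, LinearMap.proj (Function.update y i (br x (y i)))

theorem lieDer_apply {q : ℕ} (x : G) (φ : (Fin q → G) → N) (y : Fin q → G) :
    lieDer br act x φ y = act x (φ y) - ∑ i, φ (Function.update y i (br x (y i))) := by
  simp [lieDer]

/-- The Leibniz differential: unlike in the Chevalley–Eilenberg differential, the bracket of two
arguments takes the place of the second one, so that neither the bracket nor the cochains need to
be skew-symmetric. -/
def leibD (q : ℕ) : ((Fin q → G) → N) →ₗ[R] ((Fin (q + 1) → G) → N) :=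
  LinearMap.pi fun y => ∑ k : Fin (q + 1), (-1 : ℤ) ^ (k : ℕ) •
    (act (y k) ∘ₗ LinearMap.proj (k.removeNth y) - ∑ i : Fin q, if k ≤ i.castSucc then
      LinearMap.proj (Function.update (k.removeNth y) i (br (y k) (y i.succ))) else 0)

theorem leibD_apply {q : ℕ} (φ : (Fin q → G) → N) (y : Fin (q + 1) → G) :
    leibD br act q φ y = ∑ k : Fin (q + 1), (-1 : ℤ) ^ (k : ℕ) •
      (act (y k) (φ (k.removeNth y)) - ∑ i : Fin q, if k ≤ i.castSucc then
        φ (Function.update (k.removeNth y) i (br (y k) (y i.succ))) else 0) := by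
  simp [leibD, apply_ite DFunLike.coe, ite_apply]

theorem contract_leibD_zero (x : G) (φ : (Fin 0 → G) → N) :
    contract R x (leibD br act 0 φ) = lieDer br act x φ := by
  funext y
  simp [leibD_apply, lieDer_apply]

theorem removeNth_succ_cons {q : ℕ} (x : G) (y : Fin (q + 1) → G) (k : Fin (q + 1)) :
    (k.succ.removeNth (Fin.cons x y : Fin (q + 2) → G)) = Fin.cons x (k.removeNth y) := by
  funext j
  cases j using Fin.cases <;> simp [Fin.removeNth_apply]

theorem contract_leibD_succ {q : ℕ} (x : G) (φ : (Fin (q + 1) → G) → N) :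
    contract R x (leibD br act (q + 1) φ) =
      lieDer br act x φ - leibD br act q (contract R x φ) := by
  funext y
  rw [contract_apply, Pi.sub_apply, leibD_apply, Fin.sum_univ_succ,
    sub_eq_add_neg (lieDer br act x φ y)]
  congr 1
  · simp [lieDer_apply]
  · rw [leibD_apply, ← Finset.sum_neg_distrib]
    refine Finset.sum_congr rfl fun k _ => ?_
    rw [Fin.sum_univ_succ, if_neg (by simp), zero_add, Fin.val_succ, pow_succ,
      mul_neg_one, neg_smul]
    simp only [removeNth_succ_cons, contract_apply, Fin.cons_update, Fin.cons_succ, Fin.le_def,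
      Fin.val_succ, Fin.val_castSucc, Nat.add_le_add_iff_right]

theorem contract_lieDer {q : ℕ} (x z : G) (φ : (Fin (q + 1) → G) → N) :
    contract R z (lieDer br act x φ) =
      lieDer br act x (contract R z φ) - contract R (br x z) φ := by
  funext y
  simp only [contract_apply, lieDer_apply, Pi.sub_apply, Fin.sum_univ_succ, Fin.cons_zero,
    Fin.cons_succ, Fin.update_cons_zero, Fin.cons_update]
  abel

/-- The left Leibniz identity of the bracket holds inside every argument of the cochain `φ`. -/
def IsLeibniz {q : ℕ} (φ : (Fin q → G) → N) : Prop :=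
  ∀ y i x z w, φ (Function.update y i (br x (br z w))) =
    φ (Function.update y i (br (br x z) w)) + φ (Function.update y i (br z (br x w)))

variable {br act}

theorem IsLeibniz.contract {q : ℕ} {φ : (Fin (q + 1) → G) → N} (h : IsLeibniz br φ) (x : G) :
    IsLeibniz br (contract R x φ) := by
  intro y i u z w
  simp only [contract_apply, Fin.cons_update]
  exact h _ _ _ _ _

theorem IsLeibniz.contract_br {q : ℕ} {φ : (Fin (q + 1) → G) → N} (h : IsLeibniz br φ)
    (x z w : G) :
    LieConformal.contract R (br x (br z w)) φ =
      LieConformal.contract R (br (br x z) w) φ + LieConformal.contract R (br z (br x w)) φ := by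
  funext y
  simpa only [Fin.update_cons_zero, Pi.add_apply, contract_apply] using h (Fin.cons x y) 0 x z w

theorem lieDer_lieDer (hact : ∀ x y n, act x (act y n) = act (br x y) n + act y (act x n))
    {q : ℕ} {φ : (Fin q → G) → N} (h : IsLeibniz br φ) (x y : G) :
    lieDer br act x (lieDer br act y φ) =
      lieDer br act (br x y) φ + lieDer br act y (lieDer br act x φ) := by
  induction q with
  | zero =>
    funext z
    simpa [lieDer_apply] using hact x y _
  | succ q ih =>
    refine contract_ext (R := R) fun z => ?_
    simp only [map_add, contract_lieDer, map_sub, ih (h.contract z)]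
    rw [h.contract_br (R := R) x y z]
    abel

theorem lieDer_leibD (hact : ∀ x y n, act x (act y n) = act (br x y) n + act y (act x n))
    {q : ℕ} {φ : (Fin q → G) → N} (h : IsLeibniz br φ) (x : G) :
    lieDer br act x (leibD br act q φ) = leibD br act q (lieDer br act x φ) := by
  induction q with
  | zero =>
    refine contract_ext (R := R) fun y => ?_
    rw [contract_lieDer, contract_leibD_zero, contract_leibD_zero, contract_leibD_zero,
      lieDer_lieDer hact h]
    abel
  | succ q ih =>
    refine contract_ext (R := R) fun y => ?_
    simp only [contract_lieDer, contract_leibD_succ, map_sub]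
    rw [ih (h.contract y), lieDer_lieDer hact h]
    abel

theorem leibD_leibD (hact : ∀ x y n, act x (act y n) = act (br x y) n + act y (act x n))
    {q : ℕ} {φ : (Fin q → G) → N} (h : IsLeibniz br φ) :
    leibD br act (q + 1) (leibD br act q φ) = 0 := by
  induction q with
  | zero =>
    refine contract_ext (R := R) fun x => ?_
    rw [contract_leibD_succ, contract_leibD_zero, lieDer_leibD hact h, sub_self, map_zero]
  | succ q ih =>
    refine contract_ext (R := R) fun x => ?_
    rw [contract_leibD_succ, contract_leibD_succ, map_sub, lieDer_leibD hact h,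
      ih (h.contract x), sub_zero, sub_self, map_zero]

theorem leibD_zero_apply (φ : (Fin 0 → G) → N) (y : Fin 1 → G) :
    leibD br act 0 φ y = act (y 0) (φ (Fin.tail y)) := by
  simp [leibD_apply]

/-- A cochain is skew-symmetric. -/
def IsAlt {q : ℕ} (φ : (Fin q → G) → N) : Prop :=
  ∀ (σ : Equiv.Perm (Fin q)) (y : Fin q → G),
    φ (y ∘ σ) = ((Equiv.Perm.sign σ : ℤˣ) : ℤ) • φ y

theorem IsAlt.update_eq_cons {q : ℕ} {φ : (Fin (q + 1) → G) → N} (h : IsAlt φ)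
    (y : Fin (q + 1) → G) (i : Fin (q + 1)) (z : G) :
    φ (Function.update y i z) = (-1 : ℤ) ^ (i : ℕ) • φ (Fin.cons z (i.removeNth y)) := by
  have := h i.cycleRange (Fin.cons z (i.removeNth y))
  rwa [Fin.cons_comp_cycleRange, Fin.insertNth_removeNth, Fin.sign_cycleRange,
    Units.val_pow_eq_pow_val, Units.val_neg, Units.val_one] at this

theorem succ_succAbove_succAbove {q : ℕ} {k i : Fin (q + 1)} (h : k ≤ i) (j : Fin q) :
    i.succ.succAbove (k.succAbove j) = k.castSucc.succAbove (i.succAbove j) := by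
  ext
  simp only [Fin.succAbove, Fin.lt_def, Fin.le_def] at h ⊢
  grind

/-- On skew-symmetric cochains the Leibniz differential is that of Chevalley and Eilenberg. -/
theorem IsAlt.leibD_succ_apply {q : ℕ} {φ : (Fin (q + 1) → G) → N} (h : IsAlt φ)
    (y : Fin (q + 2) → G) :
    leibD br act (q + 1) φ y =
      ∑ k : Fin (q + 2), (-1 : ℤ) ^ (k : ℕ) • act (y k) (φ (k.removeNth y)) +
      ∑ l : Fin (q + 2), ∑ k : Fin (q + 1), if k.castSucc < l then
        (-1 : ℤ) ^ ((k : ℕ) + (l : ℕ)) •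
          φ (Fin.cons (br (y k.castSucc) (y l)) fun j => y (l.succAbove (k.succAbove j)))
      else 0 := by
  simp only [leibD_apply, smul_sub, Finset.sum_sub_distrib]
  rw [sub_eq_add_neg]
  congr 1
  rw [Fin.sum_univ_castSucc, Fin.sum_univ_succ (n := q + 1)]
  simp only [(Fin.castSucc_lt_last _).not_ge, Fin.not_lt_zero, if_false, Finset.sum_const_zero,
    smul_zero, zero_add, add_zero, Finset.smul_sum]
  rw [Finset.sum_comm, ← Finset.sum_neg_distrib]
  refine Finset.sum_congr rfl fun i _ => ?_
  rw [← Finset.sum_neg_distrib]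
  refine Finset.sum_congr rfl fun k _ => ?_
  rcases le_or_gt k i with hki | hki
  · rw [if_pos (Fin.castSucc_le_castSucc_iff.2 hki), if_pos (Fin.castSucc_lt_succ_iff.2 hki),
      h.update_eq_cons, smul_smul, ← neg_smul, Fin.val_succ, Fin.val_castSucc, ← add_assoc,
      pow_succ, pow_add, mul_neg_one]
    simp only [succ_succAbove_succAbove hki]
    rfl
  · rw [if_neg (by simpa using hki), if_neg (by simpa using hki), smul_zero, neg_zero]

end Leibniz

section GradedLinear

variable {P : Type*} [CommRing P] {V : Type*} [AddCommGroup V] [Module P V]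
variable {N : Type*} [AddCommGroup N] [Module P N]

variable (P) in
/-- A function of `q` arguments in `P × V` is graded linear if, for fixed first components, it is
`P`-multilinear in the second components. The first component plays the role of the variable `λᵢ`
that accompanies the argument `aᵢ` of a conformal cochain. -/
def IsGradedLinear {q : ℕ} (φ : (Fin q → P × V) → N) : Prop :=
  ∀ y i s, IsLinearMap P fun u => φ (Function.update y i (s, u))

/-- The multilinear map obtained from a graded linear function by fixing the first components. -/
def IsGradedLinear.toMultilinearMap {q : ℕ} {φ : (Fin q → P × V) → N}
    (h : IsGradedLinear P φ) (p : Fin q → P) : MultilinearMap P (fun _ : Fin q => V) N :=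
  have update_eq (x : Fin q → V) (i : Fin q) (u : V) :
      (fun j => (p j, Function.update x i u j)) =
        Function.update (fun j => (p j, x j)) i (p i, u) :=
    funext (Function.apply_update (fun j => Prod.mk (p j)) x i u)
  MultilinearMap.mk' (fun x => φ fun i => (p i, x i))
    (fun x i u v => by simpa only [update_eq] using (h _ i (p i)).map_add u v)
    (fun x i c u => by simpa only [update_eq] using (h _ i (p i)).map_smul c u)

theorem IsGradedLinear.contract {q : ℕ} {φ : (Fin (q + 1) → P × V) → N}
    (h : IsGradedLinear P φ) (x : P × V) : IsGradedLinear P (contract P x φ) := by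
  intro y i s
  simp only [contract_apply, Fin.cons_update]
  exact h _ _ _

theorem IsGradedLinear.cons {q : ℕ} {φ : (Fin (q + 1) → P × V) → N}
    (h : IsGradedLinear P φ) (s : P) (y : Fin q → P × V) :
    IsLinearMap P fun u => φ (Fin.cons (s, u) y) := by
  simpa only [Fin.update_cons_zero] using h (Fin.cons (s, 0) y) 0 s

theorem IsGradedLinear.contract_left {q : ℕ} {φ : (Fin (q + 1) → P × V) → N}
    (h : IsGradedLinear P φ) (s : P) :
    IsLinearMap P fun u => LieConformal.contract P (s, u) φ :=
  ⟨fun u v => funext fun y => (h.cons s y).map_add u v,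
    fun c u => funext fun y => (h.cons s y).map_smul c u⟩

theorem isGradedLinear_of_contract {q : ℕ} {φ : (Fin (q + 1) → P × V) → N}
    (h : ∀ x, IsGradedLinear P (contract P x φ))
    (h' : ∀ s, IsLinearMap P fun u => contract P (s, u) φ) : IsGradedLinear P φ := by
  intro y i s
  rw [← Fin.cons_self_tail y]
  cases i using Fin.cases with
  | zero =>
    simp only [Fin.update_cons_zero]
    exact (LinearMap.proj (Fin.tail y) ∘ₗ (h' s).mk' _).isLinear
  | succ j =>
    simp only [← Fin.cons_update]
    exact h (y 0) (Fin.tail y) j s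

/-- The bracket on `P × V` attached to a family of brackets on `V` indexed by `P`. -/
def gradedBr (br : P → V →ₗ[P] V →ₗ[P] V) (x y : P × V) : P × V := (x.1 + y.1, br x.1 x.2 y.2)

/-- The action of `P × V` attached to a family of actions of `V` indexed by `P`. -/
def gradedAct (act : P → V →ₗ[P] N →ₗ[P] N) (x : P × V) : N →ₗ[P] N := act x.1 x.2

variable {br : P → V →ₗ[P] V →ₗ[P] V} {act : P → V →ₗ[P] N →ₗ[P] N}

theorem IsGradedLinear.lieDer {q : ℕ} {φ : (Fin q → P × V) → N} (h : IsGradedLinear P φ)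
    (x : P × V) : IsGradedLinear P (lieDer (gradedBr br) (gradedAct act) x φ) := by
  intro y i s
  have bracket_linear : ∀ j, IsLinearMap P fun u => φ (Function.update (Function.update y i (s, u))
      j (gradedBr br x (Function.update y i (s, u) j))) := by
    intro j
    by_cases hj : j = i
    · subst hj
      simp only [Function.update_idem, Function.update_self, gradedBr]
      exact ((h y j (x.1 + s)).mk' _ ∘ₗ br x.1 x.2).isLinear
    · simp only [Function.update_of_ne hj, fun u => Function.update_comm (Ne.symm hj) (s, u)
        (gradedBr br x (y j)) y]
      exact h _ i s
  convert (gradedAct act x ∘ₗ (h y i s).mk' _ - ∑ j, (bracket_linear j).mk' _).isLinear using 1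
  ext u
  simp [lieDer_apply]

theorem IsGradedLinear.lieDer_left {q : ℕ} {φ : (Fin q → P × V) → N} (h : IsGradedLinear P φ)
    (s : P) :
    IsLinearMap P fun u => LieConformal.lieDer (gradedBr br) (gradedAct act) (s, u) φ := by
  have bracket_linear : ∀ y i,
      IsLinearMap P fun u => φ (Function.update y i (gradedBr br (s, u) (y i))) :=
    fun y i => ((h y i (s + (y i).1)).mk' _ ∘ₗ (br s).flip (y i).2).isLinear
  have lieDer_eq : (fun u => LieConformal.lieDer (gradedBr br) (gradedAct act) (s, u) φ) =
      LinearMap.pi fun y => (act s).flip (φ y) - ∑ i, (bracket_linear y i).mk' _ := by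
    ext u y
    simp [lieDer_apply, gradedAct]
  exact lieDer_eq ▸ LinearMap.isLinear _

theorem IsGradedLinear.leibD {q : ℕ} {φ : (Fin q → P × V) → N} (h : IsGradedLinear P φ) :
    IsGradedLinear P (leibD (gradedBr br) (gradedAct act) q φ) := by
  induction q with
  | zero =>
    refine isGradedLinear_of_contract (fun x => ?_) fun s => ?_
    · rw [contract_leibD_zero]
      exact h.lieDer x
    · simp only [contract_leibD_zero]
      exact h.lieDer_left s
  | succ q ih =>
    refine isGradedLinear_of_contract (fun x y i s => ?_) fun s => ?_
    · rw [contract_leibD_succ]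
      exact ((h.lieDer x y i s).mk' _ - (ih (h.contract x) y i s).mk' _).isLinear
    · simp only [contract_leibD_succ]
      exact ((h.lieDer_left s).mk' _ -
        LieConformal.leibD (gradedBr br) (gradedAct act) q ∘ₗ (h.contract_left s).mk' _).isLinear

theorem IsGradedLinear.isLeibniz
    (hbr : ∀ p r x y z, br p x (br r y z) = br (p + r) (br p x y) z + br r y (br p x z))
    {q : ℕ} {φ : (Fin q → P × V) → N} (h : IsGradedLinear P φ) :
    IsLeibniz (gradedBr br) φ := by
  intro y i x z w
  simpa only [gradedBr, hbr x.1 z.1 x.2 z.2, add_left_comm z.1, add_assoc] using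
    (h y i (x.1 + (z.1 + w.1))).map_add (br (x.1 + z.1) (br x.1 x.2 z.2) w.2)
      (br z.1 z.2 (br x.1 x.2 w.2))

end GradedLinear

section ExtendScalars

variable {F : Type*} [CommRing F] {P : Type*} [CommRing P] [Algebra F P]
variable {A : Type*} [AddCommGroup A] [Module F A]
variable {N : Type*} [AddCommGroup N] [Module F N] [Module P N] [IsScalarTower F P N]

theorem cons_one_tmul {q : ℕ} (b : A) (a : Fin q → A) :
    (fun i => (1 : P) ⊗ₜ[F] (Fin.cons b a : Fin (q + 1) → A) i) =
      Fin.cons (1 ⊗ₜ b) fun i => 1 ⊗ₜ a i :=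
  Fin.comp_cons (g := fun b : A => (1 : P) ⊗ₜ[F] b) b a

theorem multilinearMap_ext_one_tmul {N : Type*} [AddCommGroup N] [Module P N] {q : ℕ}
    {g g' : MultilinearMap P (fun _ : Fin q => P ⊗[F] A) N}
    (h : ∀ a : Fin q → A, g (fun i => 1 ⊗ₜ a i) = g' fun i => 1 ⊗ₜ a i) : g = g' := by
  induction q with
  | zero =>
    ext x
    convert h Fin.elim0
  | succ q ih =>
    suffices g.curryLeft = g'.curryLeft by
      rw [← MultilinearMap.uncurry_curryLeft g, this, MultilinearMap.uncurry_curryLeft]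
    refine LinearMap.ext fun x => ?_
    induction x with
    | zero => rw [map_zero, map_zero]
    | add x y hx hy => rw [map_add, map_add, hx, hy]
    | tmul s b =>
      rw [TensorProduct.tmul_eq_smul_one_tmul, map_smul, map_smul]
      refine congrArg (s • ·) (ih fun a => ?_)
      simpa only [cons_one_tmul, MultilinearMap.curryLeft_apply] using h (Fin.cons b a)

instance multilinearMap_isScalarTower_baseChange {q : ℕ} :
    IsScalarTower F P (MultilinearMap P (fun _ : Fin q => P ⊗[F] A) N) :=
  ⟨fun c p f => by
    ext a
    simp [smul_assoc]⟩

variable (F P A N) in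
/-- The `P`-multilinear extension of an `F`-multilinear map with values in a `P`-module. -/
def extendMulti : (q : ℕ) → MultilinearMap F (fun _ : Fin q => A) N →ₗ[F]
    MultilinearMap P (fun _ : Fin q => P ⊗[F] A) N
  | 0 =>
    { toFun := fun m => MultilinearMap.constOfIsEmpty P _ (m 0)
      map_add' := fun _ _ => rfl
      map_smul' := fun _ _ => rfl }
  | q + 1 =>
    { toFun := fun m => (LinearMap.liftBaseChange P (extendMulti q ∘ₗ m.curryLeft)).uncurryLeft
      map_add' := fun m m' => multilinearMap_ext_one_tmul fun a => by
        simp [show (m + m').curryLeft (a 0) = m.curryLeft (a 0) + m'.curryLeft (a 0) from rfl]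
      map_smul' := fun c m => multilinearMap_ext_one_tmul fun a => by
        simp [show (c • m).curryLeft (a 0) = c • m.curryLeft (a 0) from rfl] }

theorem extendMulti_one_tmul {q : ℕ} (m : MultilinearMap F (fun _ : Fin q => A) N)
    (a : Fin q → A) : extendMulti F P A N q m (fun i => 1 ⊗ₜ a i) = m a := by
  induction q with
  | zero => exact congrArg m (Subsingleton.elim _ _)
  | succ q ih =>
    simp only [extendMulti, LinearMap.coe_mk, AddHom.coe_mk, LinearMap.uncurryLeft_apply,
      LinearMap.liftBaseChange_tmul, one_smul, LinearMap.comp_apply]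
    exact (ih (m.curryLeft (a 0)) (Fin.tail a)).trans (by simp)

end ExtendScalars

section LambdaJacobi

variable {F : Type*} [Field F] {A : Type*} [AddCommGroup A] [Module F A]
variable {N : Type*} [AddCommGroup N] [Module F N]

theorem lamProd_jacobi {B : A →ₗ[F] A →ₗ[F] F[X] ⊗[F] A} {C : A →ₗ[F] N →ₗ[F] F[X] ⊗[F] N}
    (h : ∀ a b n,
      lamProd C (lam F) (1 ⊗ₜ a) (lamProd C (mu F) (1 ⊗ₜ b) (1 ⊗ₜ n)) =
        lamProd C (lam F + mu F) (lamProd B (lam F) (1 ⊗ₜ a) (1 ⊗ₜ b)) (1 ⊗ₜ n) +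
        lamProd C (mu F) (1 ⊗ₜ b) (lamProd C (lam F) (1 ⊗ₜ a) (1 ⊗ₜ n)))
    {P : Type*} [CommRing P] [Algebra F P] (p r : P) (x y : P ⊗[F] A) (z : P ⊗[F] N) :
    lamProd C p x (lamProd C r y z) =
      lamProd C (p + r) (lamProd B p x y) z + lamProd C r y (lamProd C p x z) := by
  have one_tmul_jacobi (a b n) : lamProd C p (1 ⊗ₜ a) (lamProd C r (1 ⊗ₜ b) (1 ⊗ₜ n)) =
      lamProd C (p + r) (lamProd B p (1 ⊗ₜ a) (1 ⊗ₜ b)) (1 ⊗ₜ n) +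
      lamProd C r (1 ⊗ₜ b) (lamProd C p (1 ⊗ₜ a) (1 ⊗ₜ n)) := by
    simpa only [map_add, rTensor_lamProd, LinearMap.rTensor_tmul, AlgHom.toLinearMap_apply,
      map_one, MvPolynomial.aeval_X, Matrix.cons_val_zero, Matrix.cons_val_one] using
      congrArg (LinearMap.rTensor N (MvPolynomial.aeval ![p, r]).toLinearMap) (h a b n)
  induction x with
  | zero => simp
  | add x x' hx hx' => simp only [map_add, LinearMap.add_apply, hx, hx', add_add_add_comm]
  | tmul s a =>
    induction y with
    | zero => simp
    | add y y' hy hy' => simp only [map_add, LinearMap.add_apply, hy, hy', add_add_add_comm]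
    | tmul t b =>
      induction z with
      | zero => simp
      | add z z' hz hz' => simp only [map_add, hz, hz', add_add_add_comm]
      | tmul u n =>
        rw [TensorProduct.tmul_eq_smul_one_tmul s, TensorProduct.tmul_eq_smul_one_tmul t,
          TensorProduct.tmul_eq_smul_one_tmul u]
        simp only [map_smul, LinearMap.smul_apply, one_tmul_jacobi, smul_add, smul_comm t s]

variable (F A) in
/-- The bracket `((p, x), (r, y)) ↦ (p + r, [x_p y])` on `P × (P ⊗ A)`. -/
abbrev conformalBr [Module F[X] A] [IsScalarTower F F[X] A] [LieConformalAlgebra F A]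
    (P : Type*) [CommRing P] [Algebra F P] : P × (P ⊗[F] A) → P × (P ⊗[F] A) → P × (P ⊗[F] A) :=
  gradedBr (lamProd (LieConformalAlgebra.bracket (F := F) (A := A)))

variable (F A) in
/-- The action `((p, x), n) ↦ x_p n` of `P × (P ⊗ A)` on `P ⊗ M`. -/
abbrev conformalAct [Module F[X] A] [IsScalarTower F F[X] A] [LieConformalAlgebra F A]
    (M : Type*) [AddCommGroup M] [Module F M] [Module F[X] M] [IsScalarTower F F[X] M]
    [LCModule F A M] (P : Type*) [CommRing P] [Algebra F P] :
    P × (P ⊗[F] A) → P ⊗[F] M →ₗ[P] P ⊗[F] M :=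
  gradedAct (lamProd (LCModule.act (F := F) (A := A) (M := M)))

end LambdaJacobi

section CochainExt

variable {F : Type u} {A : Type v} {M : Type w} [Field F]
variable [AddCommGroup A] [Module F A]
variable [AddCommGroup M] [Module F M]
variable {P : Type*} [CommRing P] [Algebra F P]

variable (P) in
/-- The values `f_{p₁, …, p_q}(x₁, …, x_q)` for `p i` in a commutative `F`-algebra `P`, extended
`P`-linearly to `x i ∈ P ⊗ A`. -/
def cochainExt {q : ℕ} :
    MultiMaps F A M q →ₗ[F] ((Fin q → P × (P ⊗[F] A)) → P ⊗[F] M) where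
  toFun f y := extendMulti F P A (P ⊗[F] M) q
    (LinearMap.compMultilinearMapₗ F (substVars M fun i => (y i).1) f) fun i => (y i).2
  map_add' f g := by
    simp only [map_add]
    rfl
  map_smul' c f := by
    simp only [map_smul]
    rfl

theorem isGradedLinear_cochainExt {q : ℕ} (f : MultiMaps F A M q) :
    IsGradedLinear P (cochainExt P f) := by
  intro y i s
  have fst_update (u) : (fun j => (Function.update y i (s, u) j).1) =
      Function.update (fun j => (y j).1) i s := Function.comp_update Prod.fst y i (s, u)
  have snd_update (u) : (fun j => (Function.update y i (s, u) j).2) =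
      Function.update (fun j => (y j).2) i u := Function.comp_update Prod.snd y i (s, u)
  simp only [cochainExt, LinearMap.coe_mk, AddHom.coe_mk, fst_update, snd_update]
  exact ⟨fun u v => MultilinearMap.map_update_add _ _ _ _ _,
    fun c u => MultilinearMap.map_update_smul _ _ _ _ _⟩

theorem cochainExt_one_tmul {q : ℕ} (f : MultiMaps F A M q) (p : Fin q → P) (a : Fin q → A) :
    cochainExt P f (fun i => (p i, 1 ⊗ₜ a i)) = substVars M p (f a) :=
  extendMulti_one_tmul _ _

theorem IsGradedLinear.ext {q : ℕ} {φ ψ : (Fin q → P × (P ⊗[F] A)) → P ⊗[F] M}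
    (hφ : IsGradedLinear P φ) (hψ : IsGradedLinear P ψ)
    (h : ∀ (p : Fin q → P) (a : Fin q → A),
      φ (fun i => (p i, 1 ⊗ₜ a i)) = ψ fun i => (p i, 1 ⊗ₜ a i)) : φ = ψ := by
  funext y
  have : hφ.toMultilinearMap (fun i => (y i).1) = hψ.toMultilinearMap fun i => (y i).1 :=
    multilinearMap_ext_one_tmul (h fun i => (y i).1)
  exact congrArg (fun m => m fun i => (y i).2) this

theorem cochainExt_X {q : ℕ} (f : MultiMaps F A M q) (a : Fin q → A) :
    cochainExt (MvPolynomial (Fin q) F) f (fun i => (MvPolynomial.X i, 1 ⊗ₜ a i)) = f a := by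
  rw [cochainExt_one_tmul, substVars, MvPolynomial.aeval_X_left]
  exact LinearMap.rTensor_id_apply _ _ _

theorem cochainExt_injective (q : ℕ) : Function.Injective
    (cochainExt (F := F) (A := A) (M := M) (q := q) (MvPolynomial (Fin q) F)) :=
  fun f g h => MultilinearMap.ext fun a => by rw [← cochainExt_X f, h, cochainExt_X]

variable [Module F[X] A] [IsScalarTower F F[X] A]
variable [Module F[X] M] [IsScalarTower F F[X] M]

theorem isAlt_cochainExt {q : ℕ} {f : MultiMaps F A M q}
    (hf : f ∈ cochains F A M q) : IsAlt (cochainExt P f) := by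
  intro σ y
  have : (extendMulti F P A (P ⊗[F] M) q
        ((substVars M fun i => (y (σ i)).1).compMultilinearMap f)).domDomCongr σ =
      ((Equiv.Perm.sign σ : ℤˣ) : ℤ) • extendMulti F P A (P ⊗[F] M) q
        ((substVars M fun i => (y i).1).compMultilinearMap f) := by
    refine multilinearMap_ext_one_tmul fun a => ?_
    rw [MultilinearMap.domDomCongr_apply, smul_apply, extendMulti_one_tmul, extendMulti_one_tmul]
    exact cochain_perm hf (fun i => (y i).1) σ a
  exact congrArg (fun m => m fun i => (y i).2) this

theorem cochainExt_cons {q : ℕ} (f : MultiMaps F A M (q + 1)) (s : P) (x : P ⊗[F] A)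
    (p : Fin q → P) (a : Fin q → A) :
    cochainExt P f (Fin.cons (s, x) fun i => (p i, 1 ⊗ₜ a i)) =
      insertFirst f (Fin.cons s p : Fin (q + 1) → P) x a := by
  have linear := (isGradedLinear_cochainExt (P := P) f).cons s fun i => (p i, 1 ⊗ₜ a i)
  induction x with
  | zero => rw [linear.map_zero, map_zero]; rfl
  | add x y hx hy => rw [linear.map_add, map_add, hx, hy]; rfl
  | tmul t b =>
    rw [insertFirst_tmul, TensorProduct.tmul_eq_smul_one_tmul t, linear.map_smul,
      ← cochainExt_one_tmul]
    refine congrArg (fun y => t • cochainExt P f y) (funext fun i => ?_)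
    cases i using Fin.cases <;> simp

variable [LieConformalAlgebra F A] [LCModule F A M]

theorem substVars_actionPart {q : ℕ} (f : MultiMaps F A M q) (y : Fin (q + 1) → P)
    (a : Fin (q + 1) → A) :
    substVars M y (actionPart f a) = ∑ k : Fin (q + 1), (-1 : ℤ) ^ (k : ℕ) •
      conformalAct F A M P (y k, 1 ⊗ₜ a k)
        (cochainExt P f (k.removeNth fun i => (y i, 1 ⊗ₜ a i))) := by
  rw [actionPart_apply, map_sum]
  refine Finset.sum_congr rfl fun k _ => ?_
  rw [map_zsmul, show k.removeNth (fun i => (y i, (1 : P) ⊗ₜ[F] a i)) =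
    fun j => (y (k.succAbove j), 1 ⊗ₜ a (k.succAbove j)) from rfl, cochainExt_one_tmul]
  conv_lhs => rw [substVars, rTensor_lamProd]
  simp only [LinearMap.rTensor_tmul, AlgHom.toLinearMap_apply, map_one, MvPolynomial.aeval_X,
    rTensor_substVars, gradedAct]

theorem substVars_bracketPart {q : ℕ} (f : MultiMaps F A M (q + 1)) (p : Fin (q + 2) → P)
    (a : Fin (q + 2) → A) :
    substVars M p (bracketPart f a) =
      ∑ l : Fin (q + 2), ∑ k : Fin (q + 1), if k.castSucc < l then
        (-1 : ℤ) ^ ((k : ℕ) + (l : ℕ)) • cochainExt P f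
          (Fin.cons (conformalBr F A P (p k.castSucc, 1 ⊗ₜ a k.castSucc) (p l, 1 ⊗ₜ a l)) fun j =>
            (p (l.succAbove (k.succAbove j)), 1 ⊗ₜ a (l.succAbove (k.succAbove j))))
      else 0 := by
  simp only [bracketPart_apply, map_sum]
  refine Finset.sum_congr rfl fun l _ => Finset.sum_congr rfl fun k _ => ?_
  split_ifs with h
  · rw [map_zsmul, conformalBr, gradedBr,
      cochainExt_cons f _ _ (fun j => p (l.succAbove (k.succAbove j)))
        fun j => a (l.succAbove (k.succAbove j))]
    conv_lhs => rw [substVars, rTensor_insertFirst, rTensor_lamProd]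
    simp only [LinearMap.rTensor_tmul, AlgHom.toLinearMap_apply, map_one, MvPolynomial.aeval_X]
    congr 3
    refine congrArg (insertFirst f) (funext fun i => ?_)
    cases i using Fin.cases <;> simp
  · exact map_zero _

theorem cochainExt_differential {q : ℕ} {f : MultiMaps F A M q} (hf : f ∈ cochains F A M q) :
    cochainExt P (differential F A M q f) =
      leibD (conformalBr F A P) (conformalAct F A M P) q (cochainExt P f) := by
  refine (isGradedLinear_cochainExt _).ext (isGradedLinear_cochainExt f).leibD fun p a => ?_
  rw [cochainExt_one_tmul]
  cases q with
  | zero =>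
    rw [leibD_zero_apply]
    exact (substVars_actionPart f p a).trans (by simp)
  | succ q =>
    rw [(isAlt_cochainExt hf).leibD_succ_apply]
    exact (map_add (substVars M p) (actionPart f a) (bracketPart f a)).trans
      (congrArg₂ (· + ·) (substVars_actionPart f p a) (substVars_bracketPart f p a))

theorem differential_differential [CharZero F] {q : ℕ} {f : MultiMaps F A M q}
    (hf : f ∈ cochains F A M q) :
    differential F A M (q + 1) (differential F A M q f) = 0 := by
  refine cochainExt_injective _ ?_
  rw [cochainExt_differential (differential_mem hf), cochainExt_differential hf, map_zero]
  refine leibD_leibD (fun x y n => ?_) ((isGradedLinear_cochainExt f).isLeibniz fun p r x y z => ?_)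
  · exact lamProd_jacobi (fun a b m => sub_eq_iff_eq_add.1 (LCModule.jacobi a b m)) _ _ _ _ _
  · exact lamProd_jacobi LieConformalAlgebra.jacobi _ _ _ _ _

end CochainExt

section Homotopy

variable {F : Type u} {A : Type v} {M : Type w} [Field F]
variable [AddCommGroup M] [Module F M]
variable {P : Type*} [CommRing P] [Algebra F P]

theorem derivLast_lTensor {q : ℕ} (T : M →ₗ[F] M)
    (z : MvPolynomial (Fin (q + 1)) F ⊗[F] M) :
    derivLast F M q (LinearMap.lTensor _ T z) = LinearMap.lTensor _ T (derivLast F M q z) := by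
  induction z with
  | zero => simp
  | tmul s y => simp [derivLast]
  | add y z hy hz => simp only [map_add, hy, hz]

theorem derivLast_X_last_smul {q : ℕ} (z : MvPolynomial (Fin (q + 1)) F ⊗[F] M) :
    derivLast F M q ((MvPolynomial.X (Fin.last q) : MvPolynomial (Fin (q + 1)) F) • z) =
      substVars M (Fin.snoc (fun i => MvPolynomial.X i) 0 :
        Fin (q + 1) → MvPolynomial (Fin q) F) z := by
  induction z with
  | zero => simp
  | tmul s y => simp [derivLast, substVars, TensorProduct.smul_tmul', Derivation.leibniz]
  | add y z hy hz => simp only [map_add, smul_add, hy, hz]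

theorem substLam_zero (z : F[X] ⊗[F] M) :
    substLam M (0 : P) z =
      1 ⊗ₜ TensorProduct.lid F M (LinearMap.rTensor M (Polynomial.lcoeff F 0) z) := by
  induction z with
  | zero => simp
  | tmul s y =>
    simp [substLam, TensorProduct.tmul_smul, TensorProduct.smul_tmul',
      Polynomial.aeval_def, Polynomial.eval₂_at_zero, Algebra.algebraMap_eq_smul_one]
  | add y z hy hz => simp only [map_add, TensorProduct.tmul_add, hy, hz]

theorem lamProd_zero {U V : Type*} [AddCommGroup U] [Module F U] [AddCommGroup V] [Module F V]
    (B : U →ₗ[F] V →ₗ[F] F[X] ⊗[F] M) (x : U) (z : P ⊗[F] V) :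
    lamProd B (0 : P) (1 ⊗ₜ x) z = LinearMap.lTensor P (jProd B 0 x) z := by
  induction z with
  | zero => simp
  | tmul s y =>
    rw [lamProd_tmul, substLam_zero, one_mul, TensorProduct.smul_tmul', smul_eq_mul, mul_one]
    simp [jProd]
  | add y z hy hz => simp only [map_add, hy, hz]

variable [AddCommGroup A] [Module F A] [Module F[X] A] [IsScalarTower F F[X] A]
variable [Module F[X] M] [IsScalarTower F F[X] M]

theorem derivLast_delCochain {q : ℕ} (f : MultiMaps F A M (q + 1)) (a : Fin (q + 1) → A) :
    derivLast F M q (delCochain F A M (q + 1) f a) =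
      LinearMap.lTensor _ (del F M) (derivLast F M q (f a)) +
        (∑ k : Fin q, (MvPolynomial.X k : MvPolynomial (Fin q) F)) • derivLast F M q (f a) +
      substVars M (Fin.snoc (fun i => MvPolynomial.X i) 0 :
        Fin (q + 1) → MvPolynomial (Fin q) F) (f a) := by
  rw [delCochain_apply, map_add, derivLast_lTensor, Fin.sum_univ_castSucc, add_smul,
    Finset.sum_smul, map_add, map_sum, derivLast_X_last_smul, Finset.sum_smul, add_assoc]
  simp only [derivLast_smul]

theorem cochain_snoc {q : ℕ} {f : MultiMaps F A M (q + 1)} (hf : f ∈ cochains F A M (q + 1))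
    (p : Fin q → P) (s : P) (a : Fin q → A) (b : A) :
    substVars M (Fin.snoc p s : Fin (q + 1) → P) (f (Fin.snoc a b)) =
      (-1 : ℤ) ^ q • substVars M (Fin.cons s p : Fin (q + 1) → P) (f (Fin.cons b a)) := by
  have rotate := cochain_perm hf (Fin.cons s p : Fin (q + 1) → P) (finRotate (q + 1))
    (Fin.cons b a)
  rwa [show (Fin.cons b a : Fin (q + 1) → A) ∘ finRotate (q + 1) = Fin.snoc a b from
    (Fin.snoc_eq_cons_rotate a b).symm, ← Fin.snoc_eq_cons_rotate (α := P) p s, sign_finRotate,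
    Units.val_pow_eq_pow_val, Units.val_neg, Units.val_one] at rotate

theorem tauMulti_delCochain {q : ℕ} (L : A) {f : MultiMaps F A M (q + 1)}
    (hf : f ∈ cochains F A M (q + 1)) (a : Fin q → A) :
    tauMulti L q (delCochain F A M (q + 1) f) a =
      delCochain F A M q (tauMulti L q f) a +
        substVars M (Fin.cons 0 fun i => MvPolynomial.X i :
          Fin (q + 1) → MvPolynomial (Fin q) F) (f (Fin.cons L a)) := by
  rw [tauMulti_apply, derivLast_delCochain, cochain_snoc hf, smul_add, smul_smul, ← mul_pow,
    neg_one_mul, neg_neg, one_pow, one_smul, delCochain_apply, tauMulti_apply, map_zsmul,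
    smul_add, smul_comm (∑ k : Fin q, _)]

/-- The contraction `f ↦ f_{0, λ₁, …, λ_q}(L, a₁, …, a_q)`. Its definition as a commutator makes it
plain that it preserves conformal cochains; see `contractZero_apply` for the formula. -/
def contractZero (M : Type w) [AddCommGroup M] [Module F M] [Module F[X] M]
    [IsScalarTower F F[X] M] (L : A) (q : ℕ) :
    cochains F A M (q + 1) →ₗ[F] cochains F A M q :=
  tau M L q ∘ₗ delC F A M (q + 1) - delC F A M q ∘ₗ tau M L q

variable (L : A)

theorem contractZero_apply {q : ℕ} (f : cochains F A M (q + 1)) (a : Fin q → A) :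
    (contractZero M L q f : MultiMaps F A M q) a =
      substVars M (Fin.cons 0 fun i => MvPolynomial.X i :
        Fin (q + 1) → MvPolynomial (Fin q) F) ((f : MultiMaps F A M (q + 1)) (Fin.cons L a)) :=
  sub_eq_iff_eq_add'.2 (tauMulti_delCochain L f.2 a)

theorem proj_tau_delC {q : ℕ} (f : cochains F A M (q + 1)) :
    proj (tau M L q (delC F A M (q + 1) f)) = proj (contractZero M L q f) :=
  (Submodule.Quotient.eq _).2 ⟨tau M L q f, by simp [contractZero]⟩

theorem cochainExt_contractZero {q : ℕ} (f : cochains F A M (q + 1)) :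
    cochainExt P (contractZero M L q f : MultiMaps F A M q) =
      contract P (0, 1 ⊗ₜ L) (cochainExt P (f : MultiMaps F A M (q + 1))) := by
  refine (isGradedLinear_cochainExt _).ext ((isGradedLinear_cochainExt _).contract _) fun p a => ?_
  rw [cochainExt_one_tmul, contractZero_apply, contract_apply, cochainExt_cons, insertFirst_tmul,
    one_smul]
  refine (rTensor_substVars (MvPolynomial.aeval p : MvPolynomial (Fin q) F →ₐ[F] P) _ _).trans ?_
  congr 2
  funext i
  cases i using Fin.cases <;> simp

variable [LieConformalAlgebra F A] [LCModule F A M]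

variable {L}
  (hA : jProd (LieConformalAlgebra.bracket (F := F) (A := A)) 0 L = del F A)
  (hM : jProd (LCModule.act (F := F) (A := A) (M := M)) 0 L = del F M)

include hA hM

theorem lieDer_cochainExt {q : ℕ} {f : MultiMaps F A M q} (hf : f ∈ cochains F A M q) :
    lieDer (conformalBr F A P) (conformalAct F A M P) (0, 1 ⊗ₜ L) (cochainExt P f) =
      cochainExt P (delCochain F A M q f) := by
  refine ((isGradedLinear_cochainExt f).lieDer _).ext (isGradedLinear_cochainExt _) fun p a => ?_
  have update_tmul (i : Fin q) : Function.update (fun j => (p j, (1 : P) ⊗ₜ[F] a j)) i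
      (p i, 1 ⊗ₜ del F A (a i)) = fun j => (p j, 1 ⊗ₜ Function.update a i (del F A (a i)) j) :=
    funext fun j => (Function.apply_update (fun j b => (p j, (1 : P) ⊗ₜ[F] b)) a i _ j).symm
  simp only [lieDer_apply, gradedBr, gradedAct, lamProd_zero, hA, hM, zero_add,
    LinearMap.lTensor_tmul, update_tmul, cochainExt_one_tmul, cochain_del hf]
  rw [delCochain_apply, map_add, substVars_lTensor, substVars_smul, map_sum, Finset.sum_smul,
    Finset.sum_neg_distrib, sub_neg_eq_add]
  simp only [MvPolynomial.aeval_X]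

variable [CharZero F]

theorem delC_eq_dC_add {q : ℕ} (f : cochains F A M (q + 1)) :
    delC F A M (q + 1) f =
      dC F A M q (contractZero M L q f) + contractZero M L (q + 1) (dC F A M (q + 1) f) := by
  refine Subtype.ext (cochainExt_injective _ ?_)
  have cartan := contract_leibD_succ (conformalBr F A (MvPolynomial (Fin (q + 1)) F))
    (conformalAct F A M _) (0, 1 ⊗ₜ L) (cochainExt _ (f : MultiMaps F A M (q + 1)))
  rw [lieDer_cochainExt hA hM f.2, ← cochainExt_contractZero, ← cochainExt_differential f.2,
    ← cochainExt_differential (contractZero M L q f).2, eq_sub_iff_add_eq'] at cartan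
  rw [Submodule.coe_add, map_add, cochainExt_contractZero]
  exact cartan.symm

end Homotopy

section Injective

open MvPolynomial

variable {F : Type*} [CommRing F] {σ : Type*} {M : Type*} [AddCommGroup M] [Module F M]

variable (F σ M) in
open scoped Classical in
/-- The coefficients in `M` of the monomials of an element of `F[σ] ⊗ M`. -/
def tensorCoeff : MvPolynomial σ F ⊗[F] M ≃ₗ[F] (σ →₀ ℕ) →₀ M :=
  TensorProduct.equivFinsuppOfBasisLeft (basisMonomials σ F)

theorem tensorCoeff_tmul (s : MvPolynomial σ F) (y : M) (m : σ →₀ ℕ) :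
    tensorCoeff F σ M (s ⊗ₜ y) m = s.coeff m • y := by
  classical
  exact TensorProduct.equivFinsuppOfBasisLeft_apply_tmul_apply _ s y m

theorem tensorCoeff_lTensor (T : M →ₗ[F] M) (z : MvPolynomial σ F ⊗[F] M) (m : σ →₀ ℕ) :
    tensorCoeff F σ M (LinearMap.lTensor _ T z) m = T (tensorCoeff F σ M z m) := by
  induction z with
  | zero => simp
  | tmul s y => simp [tensorCoeff_tmul]
  | add y z hy hz => simp only [map_add, Finsupp.add_apply, hy, hz]

theorem tensorCoeff_X_smul (i : σ) (z : MvPolynomial σ F ⊗[F] M) (m : σ →₀ ℕ) :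
    tensorCoeff F σ M ((X i : MvPolynomial σ F) • z) m =
      if m i = 0 then 0 else tensorCoeff F σ M z (m - Finsupp.single i 1) := by
  classical
  induction z with
  | zero => simp
  | tmul s y =>
    simp only [TensorProduct.smul_tmul', smul_eq_mul, tensorCoeff_tmul,
      coeff_X_mul', Finsupp.mem_support_iff, ite_not, ite_smul, zero_smul]
  | add y z hy hz =>
    simp only [map_add, smul_add, Finsupp.add_apply, hy, hz]
    split_ifs <;> simp

theorem lTensor_add_sum_X_smul_eq_zero [Fintype σ] (i : σ) (T : M →ₗ[F] M)
    {z : MvPolynomial σ F ⊗[F] M}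
    (h : LinearMap.lTensor _ T z + (∑ k : σ, (X k : MvPolynomial σ F)) • z = 0) : z = 0 := by
  by_contra z_ne_zero
  obtain ⟨n, n_mem, n_max⟩ := (tensorCoeff F σ M z).support.exists_max_image (· i) <| by
    simpa [Finsupp.support_nonempty_iff] using z_ne_zero
  have coeff_eq_zero (m : σ →₀ ℕ) (hm : m i = n i + 1) : tensorCoeff F σ M z m = 0 := by
    by_contra hz
    have := n_max m (Finsupp.mem_support_iff.2 hz)
    lia
  set m := n + Finsupp.single i 1 with m_def
  have coeff_h : T (tensorCoeff F σ M z m) + ∑ k,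
      (if m k = 0 then 0 else tensorCoeff F σ M z (m - Finsupp.single k 1)) = 0 := by
    simpa only [map_add, Finset.sum_smul, map_sum, Finsupp.add_apply, Finsupp.finsetSum_apply,
      tensorCoeff_lTensor, tensorCoeff_X_smul, map_zero, Finsupp.zero_apply] using
      congrArg (fun w => tensorCoeff F σ M w m) h
  rw [coeff_eq_zero _ (by simp [m_def]), map_zero, zero_add, Fintype.sum_eq_single i fun k hk => by
    rw [coeff_eq_zero _ (by simp [m_def, hk]), ite_self], if_neg (by simp [m_def]), m_def,
    add_tsub_cancel_right] at coeff_h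
  exact Finsupp.mem_support_iff.1 n_mem coeff_h

end Injective

section Cochains

variable {F : Type u} {A : Type v} {M : Type w} [Field F]
variable [AddCommGroup A] [Module F A] [Module F[X] A] [IsScalarTower F F[X] A]
variable [AddCommGroup M] [Module F M] [Module F[X] M] [IsScalarTower F F[X] M]

theorem delC_injective (q : ℕ) : Function.Injective (delC F A M (q + 1)) := by
  refine (injective_iff_map_eq_zero _).2 fun f hf => Subtype.ext (MultilinearMap.ext fun a => ?_)
  exact lTensor_add_sum_X_smul_eq_zero 0 (del F M) (congrArg (fun g => g.1 a) hf)

variable [CharZero F] [LieConformalAlgebra F A] [LCModule F A M]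

theorem dC_dC {q : ℕ} (f : cochains F A M q) : dC F A M (q + 1) (dC F A M q f) = 0 :=
  Subtype.ext (differential_differential f.2)

variable {L : A}
  (hA : jProd (LieConformalAlgebra.bracket (F := F) (A := A)) 0 L = del F A)
  (hM : jProd (LCModule.act (F := F) (A := A) (M := M)) 0 L = del F M)

include hA hM

theorem isInjectiveNullHomotopy_delC :
    IsInjectiveNullHomotopy (dC F A M) (delC F A M) (contractZero M L) where
  d_d _ := dC_dC
  d_comm := dC_delC F A M
  homotopy _ := delC_eq_dC_add hA hM
  injective := delC_injective

theorem isReducedClass_cohomologyEquiv_inl {q : ℕ} (f : basicCocycles F A M (q + 1)) :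
    IsReducedClass ((isInjectiveNullHomotopy_delC hA hM).cohomologyEquiv q (basicClass f, 0))
      (f : cochains F A M (q + 1)) :=
  ⟨((isInjectiveNullHomotopy_delC hA hM).projCocycle (q + 1) f).2,
    (isInjectiveNullHomotopy_delC hA hM).cohomologyEquiv_inl q f⟩

theorem isReducedClass_cohomologyEquiv_inr {q : ℕ} (g : basicCocycles F A M (q + 2)) :
    IsReducedClass ((isInjectiveNullHomotopy_delC hA hM).cohomologyEquiv q (0, basicClass g))
      (tau M L (q + 1) (delC F A M (q + 2) (g : cochains F A M (q + 2)))) := by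
  have proj_eq := proj_tau_delC L (g : cochains F A M (q + 2))
  have proj_mem_ker :
      proj (tau M L (q + 1) (delC F A M (q + 2) (g : cochains F A M (q + 2)))) ∈
        reducedCocycles F A M (q + 1) := by
    rw [proj_eq]
    exact ((isInjectiveNullHomotopy_delC hA hM).homotopyCocycle (q + 1) g).2
  exact ⟨proj_mem_ker, ((isInjectiveNullHomotopy_delC hA hM).cohomologyEquiv_inr q g).trans
    (congrArg Submodule.Quotient.mk (Subtype.ext proj_eq.symm))⟩

end Cochains

end LieConformal

end

theorem mainTheorem2_general {F : Type*} {A : Type*} {M : Type*} [Field F] [CharZero F]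
    [AddCommGroup A] [Module F A] [Module F[X] A] [IsScalarTower F F[X] A]
    [LieConformalAlgebra F A]
    [AddCommGroup M] [Module F M] [Module F[X] M] [IsScalarTower F F[X] M]
    [LCModule F A M]
    (L : A) (hA : jProd (LieConformalAlgebra.bracket (F := F) (A := A)) 0 L = del F A)
    (hM : jProd (LCModule.act (F := F) (A := A) (M := M)) 0 L = del F M) (q : ℕ) (hq : 1 ≤ q) :
    Module.rank F (ReducedCohomology F A M q) =
        Module.rank F (BasicCohomology F A M q) + Module.rank F (BasicCohomology F A M (q + 1)) ∧
      ∀ (ι : Type*) (κ : Type*) (b : Module.Basis ι F (BasicCohomology F A M q))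
        (c : Module.Basis κ F (BasicCohomology F A M (q + 1)))
        (f : ι → basicCocycles F A M q) (g : κ → basicCocycles F A M (q + 1)),
        (∀ i, b i = basicClass (f i)) → (∀ j, c j = basicClass (g j)) →
        ∃ B : Module.Basis (ι ⊕ κ) F (ReducedCohomology F A M q),
          (∀ i, IsReducedClass (B (Sum.inl i)) (f i : cochains F A M q)) ∧
          (∀ j, IsReducedClass (B (Sum.inr j))
            (tau M L q (delC F A M (q + 1) (g j : cochains F A M (q + 1))))) := by
  obtain ⟨q, rfl⟩ : ∃ p, q = p + 1 := Nat.exists_eq_add_of_le' hq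
  let e : (BasicCohomology F A M (q + 1) × BasicCohomology F A M (q + 2)) ≃ₗ[F]
      ReducedCohomology F A M (q + 1) := (isInjectiveNullHomotopy_delC hA hM).cohomologyEquiv q
  refine ⟨by rw [← e.rank_eq, rank_prod'], fun ι κ b c f g hf hg =>
    ⟨(b.prod c).map e, fun i => ?_, fun j => ?_⟩⟩
  · rw [Module.Basis.map_apply, Module.Basis.prod_apply, Sum.elim_inl, Function.comp_apply,
      LinearMap.inl_apply, hf]
    exact isReducedClass_cohomologyEquiv_inl hA hM (f i)
  · rw [Module.Basis.map_apply, Module.Basis.prod_apply, Sum.elim_inr, Function.comp_apply,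
      LinearMap.inr_apply, hg]
    exact isReducedClass_cohomologyEquiv_inr hA hM (g j)

theorem mainTheorem2 {F : Type*} {A : Type*} {M : Type*} [Field F] [CharZero F]
    [AddCommGroup A] [Module F A] [Module F[X] A] [IsScalarTower F F[X] A] [Module.Free F[X] A]
    [LieConformalAlgebra F A]
    [AddCommGroup M] [Module F M] [Module F[X] M] [IsScalarTower F F[X] M] [Module.Free F[X] M]
    [LCModule F A M]
    (L : A) (hL : IsVirasoroElement F L) (hM : IsConformalModule F L M) (q : ℕ) (hq : 1 ≤ q) :
    Module.rank F (ReducedCohomology F A M q) =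
        Module.rank F (BasicCohomology F A M q) + Module.rank F (BasicCohomology F A M (q + 1)) ∧
      ∀ (ι : Type*) (κ : Type*) (b : Module.Basis ι F (BasicCohomology F A M q))
        (c : Module.Basis κ F (BasicCohomology F A M (q + 1)))
        (f : ι → basicCocycles F A M q) (g : κ → basicCocycles F A M (q + 1)),
        (∀ i, b i = basicClass (f i)) → (∀ j, c j = basicClass (g j)) →
        ∃ B : Module.Basis (ι ⊕ κ) F (ReducedCohomology F A M q),
          (∀ i, IsReducedClass (B (Sum.inl i)) (f i : cochains F A M q)) ∧
          (∀ j, IsReducedClass (B (Sum.inr j))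
            (tau M L q (delC F A M (q + 1) (g j : cochains F A M (q + 1))))) :=
  mainTheorem2_general L hL.zero_prod hM.zero_prod q hq
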